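/- Let $w_0,w_1,\dots$ be i.i.d. square-integrable random vectors in $\mathbb R^{n_w}$ with $\mathbb E[w_k]=0$ and $\mathbb E[w_kw_k^\top]=\Sigma$, and consider the system $$x_{k+1}=A(w_k)x_k+B(w_k)u_k,\qquad A(w)=A_0+\sum_{i=1}^{n_w}w^{(i)}A_i,\quad B(w)=B_0+\sum_{i=1}^{n_w}w^{(i)}B_i,$$ with $x_k\in\mathbb R^{n_x}$, $u_k\in\mathbb R^{n_u}$ and cost $\mathbb E\big[\sum_{k\ge0}x_k^\top Qx_k+u_k^\top Ru_k\big]$, where $Q\succ0$ and $R\succ0$. Assume the system is mean square stabilizable: for some gain $K$, the closed loop $x_{k+1}=(A(w_k)+B(w_k)K)x_k$ satisfies $\mathbb E\|x_k\|^2\to0$ for every $x_0$. Put $\Sigma_0=\begin{pmatrix}1&0\\0&\Sigma\end{pmatrix}$ and let $\mathbf A$, $\mathbf B$ be the block columns with blocks $A_0,\dots,A_{n_w}$ and $B_0,\dots,B_{n_w}$. For a symmetric positive semidefinite matrix $S$ of size $1+n_w$, the controller synthesized for $S$ is $$K=-\big(R+\mathbf B^\top(S\otimes P)\mathbf B\big)^{-1}\mathbf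 B^\top(S\otimes P)\mathbf A,$$ where $P\succeq0$ solves the Riccati equation $$P=Q+\mathbf A^\top(S\otimes P)\mathbf A-\mathbf A^\top(S\otimes P)\mathbf B\big(R+\mathbf B^\top(S\otimes P)\mathbf B\big)^{-1}\mathbf B^\top(S\otimes P)\mathbf A .$$ Let $-1\le\underline\lambda_N\le0\le\bar\lambda_N$ be sequences with $\underline\lambda_N=\mathcal O(1/\sqrt N)$ and $\bar\lambda_N=\mathcal O(1/\sqrt N)$. Then the controller $K^\star$ synthesized for $\Sigma_0$ (the nominal controller) exists, is unique, and for every $x_0$ its closed-loop cost $J^\star(x_0)$ is finite and equals the infimum of the cost over all input processes for which $u_k$ is a measurable function of $w_0,\dots,w_{k-1}$. Moreover there are a constant $C$ and an $N_0$, independent of $x_0$ and of the estimate, such that for every $N\ge N_0$ and every estimate $\hat\Sigma_0$ with $$\underline\lambda_N\,\Sigma_0\preceq\hat\Sigma_0-\Sigma_0\preceq\bar\lambda_N\,\Sigma_0,$$ the controller $\hat K$ synthesized for $\hat\Sigma_0$ (the empirical controller) exists and is unique, and the cost $\hat J(x_0)$ of applying $u_k=\hat Kx_k$ to the true system is finite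 for every $x_0$ and satisfies $$\big|\hat J(x_0)-J^\star(x_0)\big|\le\frac{C\,\|x_0\|^2}{N},$$ that is, $\hat J(x_0)-J^\star(x_0)=\mathcal O(1/N)$. -/

import Mathlib

open MeasureTheory ProbabilityTheory Filter Topology
open scoped ENNReal Matrix Kronecker

noncomputable section

namespace MultNoiseLQR

/-! ### The system with multiplicative noise -/

/-- `M(w) = M₀ + ∑ i, w⁽ⁱ⁾ Mᵢ`. -/
def noisyMatrix {nw m n : ℕ} (M : Fin (nw + 1) → Matrix (Fin m) (Fin n) ℝ) (w : Fin nw → ℝ) :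
    Matrix (Fin m) (Fin n) ℝ :=
  M 0 + ∑ i : Fin nw, w i • M i.succ

/-- The state of `x_{k+1} = A(w_k) x_k + B(w_k) u_k` driven by an input process `u`. -/
def state {Ω : Type*} {nw nx nu : ℕ} (A : Fin (nw + 1) → Matrix (Fin nx) (Fin nx) ℝ)
    (B : Fin (nw + 1) → Matrix (Fin nx) (Fin nu) ℝ) (w : ℕ → Ω → Fin nw → ℝ)
    (u : ℕ → Ω → Fin nu → ℝ) (x₀ : Fin nx → ℝ) : ℕ → Ω → Fin nx → ℝ
  | 0, _ => x₀
  | k + 1, ω =>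
      noisyMatrix A (w k ω) *ᵥ state A B w u x₀ k ω + noisyMatrix B (w k ω) *ᵥ u k ω

/-- The state of the closed loop `x_{k+1} = (A(w_k) + B(w_k) K) x_k`. -/
def closedLoop {Ω : Type*} {nw nx nu : ℕ} (A : Fin (nw + 1) → Matrix (Fin nx) (Fin nx) ℝ)
    (B : Fin (nw + 1) → Matrix (Fin nx) (Fin nu) ℝ) (w : ℕ → Ω → Fin nw → ℝ)
    (K : Matrix (Fin nu) (Fin nx) ℝ) (x₀ : Fin nx → ℝ) : ℕ → Ω → Fin nx → ℝ
  | 0, _ => x₀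
  | k + 1, ω =>
      (noisyMatrix A (w k ω) + noisyMatrix B (w k ω) * K) *ᵥ closedLoop A B w K x₀ k ω

/-- The closed loop under the gain `K` is mean square stable: `E ‖x_k‖² → 0` for every `x₀`. -/
def MeanSquareStable {Ω : Type*} [MeasurableSpace Ω] (μ : Measure Ω) {nw nx nu : ℕ}
    (A : Fin (nw + 1) → Matrix (Fin nx) (Fin nx) ℝ)
    (B : Fin (nw + 1) → Matrix (Fin nx) (Fin nu) ℝ) (w : ℕ → Ω → Fin nw → ℝ)
    (K : Matrix (Fin nu) (Fin nx) ℝ) : Prop :=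
  ∀ x₀ : Fin nx → ℝ, Tendsto
    (fun k => ∫⁻ ω, ENNReal.ofReal
      (closedLoop A B w K x₀ k ω ⬝ᵥ closedLoop A B w K x₀ k ω) ∂μ) atTop (𝓝 0)

/-! ### The quadratic cost -/

/-- `E [∑ k, x_kᵀ Q x_k + u_kᵀ R u_k]`, as an extended nonnegative real
(for positive definite `Q` and `R` all the summands are nonnegative). -/
def quadCost {Ω : Type*} [MeasurableSpace Ω] (μ : Measure Ω) {nx nu : ℕ}
    (Q : Matrix (Fin nx) (Fin nx) ℝ) (R : Matrix (Fin nu) (Fin nu) ℝ)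
    (x : ℕ → Ω → Fin nx → ℝ) (u : ℕ → Ω → Fin nu → ℝ) : ℝ≥0∞ :=
  ∫⁻ ω, ∑' k, ENNReal.ofReal (x k ω ⬝ᵥ Q *ᵥ x k ω + u k ω ⬝ᵥ R *ᵥ u k ω) ∂μ

/-- The closed-loop cost of the feedback `u_k = K x_k` from the initial state `x₀`. -/
def closedLoopCost {Ω : Type*} [MeasurableSpace Ω] (μ : Measure Ω) {nw nx nu : ℕ}
    (A : Fin (nw + 1) → Matrix (Fin nx) (Fin nx) ℝ)
    (B : Fin (nw + 1) → Matrix (Fin nx) (Fin nu) ℝ)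
    (Q : Matrix (Fin nx) (Fin nx) ℝ) (R : Matrix (Fin nu) (Fin nu) ℝ)
    (w : ℕ → Ω → Fin nw → ℝ) (K : Matrix (Fin nu) (Fin nx) ℝ) (x₀ : Fin nx → ℝ) : ℝ≥0∞ :=
  quadCost μ Q R (closedLoop A B w K x₀) (fun k ω => K *ᵥ closedLoop A B w K x₀ k ω)

/-- `u` is a non-anticipative input: `u_k` is a measurable function of `w_0, …, w_{k-1}`. -/
def NonAnticipative {Ω : Type*} {nw nu : ℕ} (w : ℕ → Ω → Fin nw → ℝ)
    (u : ℕ → Ω → Fin nu → ℝ) : Prop :=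
  ∀ k, Measurable[⨆ j : Fin k, MeasurableSpace.comap (w j) inferInstance] (u k)

/-- The optimal value of the stochastic LQR problem: the infimum of the cost over all
non-anticipative input processes. -/
def optimalCost {Ω : Type*} [MeasurableSpace Ω] (μ : Measure Ω) {nw nx nu : ℕ}
    (A : Fin (nw + 1) → Matrix (Fin nx) (Fin nx) ℝ)
    (B : Fin (nw + 1) → Matrix (Fin nx) (Fin nu) ℝ)
    (Q : Matrix (Fin nx) (Fin nx) ℝ) (R : Matrix (Fin nu) (Fin nu) ℝ)
    (w : ℕ → Ω → Fin nw → ℝ) (x₀ : Fin nx → ℝ) : ℝ≥0∞ :=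
  ⨅ (u : ℕ → Ω → Fin nu → ℝ) (_ : NonAnticipative w u),
    quadCost μ Q R (state A B w u x₀) u

/-! ### The Riccati equation and the controller it yields -/

/-- The augmented covariance `Σ₀ = [1 0; 0 Σ]`. -/
def augCov {nw : ℕ} (S : Matrix (Fin nw) (Fin nw) ℝ) :
    Matrix (Fin (nw + 1)) (Fin (nw + 1)) ℝ :=
  Matrix.of fun i j =>
    Fin.cases (Fin.cases 1 (fun _ => 0) j) (fun i' => Fin.cases 0 (fun j' => S i' j') j) i

/-- The block column with blocks `M₀, …, M_{nw}`. -/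
def stack {nw m n : ℕ} (M : Fin (nw + 1) → Matrix (Fin m) (Fin n) ℝ) :
    Matrix (Fin (nw + 1) × Fin m) (Fin n) ℝ :=
  Matrix.of fun p j => M p.1 p.2 j

/-- `𝐌ᵀ (S ⊗ P) 𝐍`, for the block columns `𝐌`, `𝐍` of the families `M`, `N`. -/
def sandwich {nw nx m n : ℕ} (M : Fin (nw + 1) → Matrix (Fin nx) (Fin m) ℝ)
    (N : Fin (nw + 1) → Matrix (Fin nx) (Fin n) ℝ)
    (S : Matrix (Fin (nw + 1)) (Fin (nw + 1)) ℝ) (P : Matrix (Fin nx) (Fin nx) ℝ) :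
    Matrix (Fin m) (Fin n) ℝ :=
  (stack M)ᵀ * (S ⊗ₖ P) * stack N

/-- The Riccati residual `P - Q - F(P) + H(P)ᵀ (R + G(P))⁻¹ H(P)` with `F(P) = 𝐀ᵀ(S ⊗ P)𝐀`,
`G(P) = 𝐁ᵀ(S ⊗ P)𝐁` and `H(P) = 𝐁ᵀ(S ⊗ P)𝐀`. -/
def riccati {nw nx nu : ℕ} (A : Fin (nw + 1) → Matrix (Fin nx) (Fin nx) ℝ)
    (B : Fin (nw + 1) → Matrix (Fin nx) (Fin nu) ℝ)
    (Q : Matrix (Fin nx) (Fin nx) ℝ) (R : Matrix (Fin nu) (Fin nu) ℝ)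
    (P : Matrix (Fin nx) (Fin nx) ℝ) (S : Matrix (Fin (nw + 1)) (Fin (nw + 1)) ℝ) :
    Matrix (Fin nx) (Fin nx) ℝ :=
  P - Q - sandwich A A S P
    + (sandwich B A S P)ᵀ * (R + sandwich B B S P)⁻¹ * sandwich B A S P

/-- `K` is the controller synthesised for the augmented covariance `S`:
`K = -(R + G(P))⁻¹ H(P)` with `P` a positive semidefinite solution of the Riccati equation. -/
def IsLQRController {nw nx nu : ℕ} (A : Fin (nw + 1) → Matrix (Fin nx) (Fin nx) ℝ)
    (B : Fin (nw + 1) → Matrix (Fin nx) (Fin nu) ℝ)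
    (Q : Matrix (Fin nx) (Fin nx) ℝ) (R : Matrix (Fin nu) (Fin nu) ℝ)
    (S : Matrix (Fin (nw + 1)) (Fin (nw + 1)) ℝ) (K : Matrix (Fin nu) (Fin nx) ℝ) : Prop :=
  ∃ P : Matrix (Fin nx) (Fin nx) ℝ, P.PosSemidef ∧ riccati A B Q R P S = 0 ∧
    K = -((R + sandwich B B S P)⁻¹ * sandwich B A S P)

/-- `lb • S₀ ≼ Ŝ - S₀ ≼ ub • S₀` in the Loewner order. -/
def CovBound {n : ℕ} (lb ub : ℝ) (S₀ Shat : Matrix (Fin n) (Fin n) ℝ) : Prop :=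
  ((Shat - S₀) - lb • S₀).PosSemidef ∧ (ub • S₀ - (Shat - S₀)).PosSemidef

end MultNoiseLQR

end

/-! Only the second moment of the augmented noise `(1, w)` enters: the expected value of `x₊ᵀ P x₊`
is the quadratic form `nextValue`, monotone in `P` and in `S`. Completing the square (`qValue_eq`)
turns the Riccati equation into the fixed-point equation of a minimization over `u`, so everything
reduces to comparing quadratic forms.

Since `Q` is positive definite, a solution `P` satisfies `ε P ≼ Q` for some `ε > 0`, so each step
consumes a fixed fraction of the value. This makes solutions unique without any stability
requirement (`qf_le_of_le_qValue`) and lets a small relative error be absorbed by inflating `P`.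
Existence follows from value iteration below a supersolution (`exists_bellman_fixed`), which
stabilizability supplies (`exists_supersolution`). Telescoping identifies `qf P x₀` with the optimal
cost (`closedLoopCost_le`, `le_quadCost`).

The rate `1/N`, rather than `1/√N`, comes from optimality. A relative covariance error `δ = O(1/√N)`
changes value matrices by a factor `1 + O(δ)` (`exists_bellman_fixed_of_cov_le`) and gains by `O(δ)`
(`qf_gain_sub_le`). The true gain minimizes a quadratic, so a gain error `O(δ)` costs only `O(δ²)`
per step. Hence `(1 + O(δ²)) P` is a supersolution for the empirical gain on the true system
(`exists_bellman_fixed_suboptimal`), bounding its cost from above; optimality of `P` bounds it from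
below. -/

noncomputable section

namespace MultNoiseLQR

/-! ### Quadratic forms -/

/-- The quadratic form `xᵀ M x`. -/
def qf {n : Type*} [Fintype n] (M : Matrix n n ℝ) (x : n → ℝ) : ℝ := x ⬝ᵥ M *ᵥ x

section QuadraticForms

variable {n m : Type*} [Fintype n] [Fintype m]

lemma qf_add (M N : Matrix n n ℝ) (x : n → ℝ) : qf (M + N) x = qf M x + qf N x := by
  simp [qf, Matrix.add_mulVec]

lemma qf_sub (M N : Matrix n n ℝ) (x : n → ℝ) : qf (M - N) x = qf M x - qf N x := by
  simp [qf, Matrix.sub_mulVec]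

lemma qf_smul (c : ℝ) (M : Matrix n n ℝ) (x : n → ℝ) : qf (c • M) x = c * qf M x := by
  simp [qf, Matrix.smul_mulVec]

lemma qf_zero (x : n → ℝ) : qf (0 : Matrix n n ℝ) x = 0 := by simp [qf]

lemma qf_vec_zero (M : Matrix n n ℝ) : qf M 0 = 0 := by simp [qf]

lemma qf_one [DecidableEq n] (x : n → ℝ) : qf (1 : Matrix n n ℝ) x = x ⬝ᵥ x := by simp [qf]

lemma qf_vec_smul (M : Matrix n n ℝ) (c : ℝ) (x : n → ℝ) : qf M (c • x) = c ^ 2 * qf M x := by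
  simp [qf, Matrix.mulVec_smul]; ring

lemma qf_vec_add {M : Matrix n n ℝ} (hM : M.IsHermitian) (x y : n → ℝ) :
    qf M (x + y) = qf M x + 2 * (x ⬝ᵥ M *ᵥ y) + qf M y := by
  have h : y ⬝ᵥ M *ᵥ x = x ⬝ᵥ M *ᵥ y := by
    have hT : Mᵀ = M := by simpa [Matrix.conjTranspose_eq_transpose_of_trivial] using hM.eq
    rw [← Matrix.dotProduct_transpose_mulVec, hT]
  simp only [qf, Matrix.mulVec_add, dotProduct_add, add_dotProduct, h]; ring

lemma qf_mulVec (M : Matrix n n ℝ) (C : Matrix n m ℝ) (x : m → ℝ) :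
    qf M (C *ᵥ x) = qf (Cᵀ * M * C) x := by
  simp only [qf, ← Matrix.mulVec_mulVec, Matrix.mulVec_transpose]
  rw [dotProduct_comm x, ← Matrix.dotProduct_mulVec, dotProduct_comm]

lemma qf_nonneg {M : Matrix n n ℝ} (hM : M.PosSemidef) (x : n → ℝ) : 0 ≤ qf M x := by
  simpa [qf] using hM.dotProduct_mulVec_nonneg x

lemma posSemidef_of_qf_nonneg {M : Matrix n n ℝ} (hM : M.IsHermitian) (h : ∀ x, 0 ≤ qf M x) :
    M.PosSemidef :=
  .of_dotProduct_mulVec_nonneg hM (by simpa [qf] using h)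

lemma qf_pos {M : Matrix n n ℝ} (hM : M.PosDef) {x : n → ℝ} (hx : x ≠ 0) : 0 < qf M x := by
  simpa [qf] using hM.dotProduct_mulVec_pos hx

lemma continuous_qf (M : Matrix n n ℝ) : Continuous (qf M) := by
  unfold qf; fun_prop

/-- A hermitian matrix is determined by its quadratic form. -/
lemma apply_eq_qf [DecidableEq n] {M : Matrix n n ℝ} (hM : M.IsHermitian) (i j : n) :
    M i j = (qf M (Pi.single i 1 + Pi.single j 1) - qf M (Pi.single i 1)
      - qf M (Pi.single j 1)) / 2 := by
  rw [qf_vec_add hM]; simp; ring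

lemma eq_of_qf_eq {M N : Matrix n n ℝ} (hM : M.IsHermitian) (hN : N.IsHermitian)
    (h : ∀ x, qf M x = qf N x) : M = N := by
  classical
  ext i j
  rw [apply_eq_qf hM, apply_eq_qf hN, h, h, h]

/-- Every quadratic form is dominated by a multiple of a positive definite one. -/
lemma exists_qf_le {Q : Matrix n n ℝ} (hQ : Q.PosDef) (M : Matrix n n ℝ) :
    ∃ c : ℝ, 1 ≤ c ∧ ∀ x, qf M x ≤ c * qf Q x := by
  classical
  have hcomp : IsCompact (Metric.sphere (0 : n → ℝ) 1) := isCompact_sphere 0 1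
  have hne : ∀ x ∈ Metric.sphere (0 : n → ℝ) 1, qf Q x ≠ 0 := fun x hx => by
    refine (qf_pos hQ ?_).ne'
    rintro rfl
    simp at hx
  obtain ⟨c, hc⟩ := hcomp.exists_bound_of_continuousOn
    (f := fun x => qf M x / qf Q x)
    ((continuous_qf M).continuousOn.div (continuous_qf Q).continuousOn hne)
  -- The maximum with 1 lets later arguments use the inverse of the constant as a number in `(0,
  -- 1]`.
  refine ⟨max c 1, le_max_right _ _, fun x => ?_⟩
  rcases eq_or_ne x 0 with rfl | hx
  · simp [qf_vec_zero]
  have hnx : ‖x‖ ≠ 0 := norm_ne_zero_iff.mpr hx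
  have hmem : ‖x‖⁻¹ • x ∈ Metric.sphere (0 : n → ℝ) 1 := by
    simp [norm_smul, hnx]
  have h := (Real.norm_eq_abs _ ▸ le_abs_self _).trans (hc _ hmem)
  simp only [qf_vec_smul] at h
  rw [mul_div_mul_left _ _ (by positivity), div_le_iff₀ (qf_pos hQ hx)] at h
  exact h.trans (mul_le_mul_of_nonneg_right (le_max_left _ _) (qf_pos hQ hx).le)

lemma qf_kronecker (S : Matrix m m ℝ) (P : Matrix n n ℝ) (y : m × n → ℝ) :
    qf (S ⊗ₖ P) y
      = ∑ i, ∑ j, S i j * ((fun a => y (i, a)) ⬝ᵥ P *ᵥ fun b => y (j, b)) := by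
  simp only [qf, dotProduct, Matrix.mulVec, Fintype.sum_prod_type, Matrix.kroneckerMap_apply,
    Finset.mul_sum]
  refine Finset.sum_congr rfl fun i _ => ?_
  rw [Finset.sum_comm]
  refine Finset.sum_congr rfl fun j _ => Finset.sum_congr rfl fun a _ =>
    Finset.sum_congr rfl fun b _ => ?_
  ring

lemma qf_kronecker_mono_left {S S' : Matrix m m ℝ} {P : Matrix n n ℝ} (h : (S' - S).PosSemidef)
    (hP : P.PosSemidef) (y : m × n → ℝ) : qf (S ⊗ₖ P) y ≤ qf (S' ⊗ₖ P) y := by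
  have := qf_nonneg (h.kronecker hP) y
  simp only [qf_kronecker, Matrix.sub_apply, sub_mul, Finset.sum_sub_distrib] at this ⊢
  linarith

lemma qf_kronecker_smul_left (c : ℝ) (S : Matrix m m ℝ) (P : Matrix n n ℝ) (y : m × n → ℝ) :
    qf ((c • S) ⊗ₖ P) y = c * qf (S ⊗ₖ P) y := by
  rw [Matrix.smul_kronecker, qf_smul]

lemma qf_kronecker_smul_right (c : ℝ) (S : Matrix m m ℝ) (P : Matrix n n ℝ) (y : m × n → ℝ) :
    qf (S ⊗ₖ (c • P)) y = c * qf (S ⊗ₖ P) y := by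
  rw [Matrix.kronecker_smul, qf_smul]

lemma qf_kronecker_mono_right {S : Matrix m m ℝ} {P P' : Matrix n n ℝ} (hS : S.PosSemidef)
    (hP : P.IsHermitian) (hP' : P'.IsHermitian) (h : ∀ x, qf P x ≤ qf P' x)
    (y : m × n → ℝ) : qf (S ⊗ₖ P) y ≤ qf (S ⊗ₖ P') y := by
  have h' : (P' - P).PosSemidef :=
    posSemidef_of_qf_nonneg (hP'.sub hP) fun x => by rw [qf_sub]; linarith [h x]
  have := qf_nonneg (hS.kronecker h') y
  have h2 : S ⊗ₖ P' = S ⊗ₖ (P' - P) + S ⊗ₖ P := by rw [← Matrix.kronecker_add]; simp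
  rw [h2, qf_add]
  linarith

end QuadraticForms

/-! ### The Bellman operator -/

section Bellman

variable {nw nx nu : ℕ} (A : Fin (nw + 1) → Matrix (Fin nx) (Fin nx) ℝ)
  (B : Fin (nw + 1) → Matrix (Fin nx) (Fin nu) ℝ)
  (Q : Matrix (Fin nx) (Fin nx) ℝ) (R : Matrix (Fin nu) (Fin nu) ℝ)
  (S : Matrix (Fin (nw + 1)) (Fin (nw + 1)) ℝ) (P : Matrix (Fin nx) (Fin nx) ℝ)

/-- The expectation of `x₊ᵀ P x₊` for the successor state `x₊ = A(w) x + B(w) u`, when the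
augmented second moment of the noise is `S`. -/
def nextValue (x : Fin nx → ℝ) (u : Fin nu → ℝ) : ℝ :=
  qf (S ⊗ₖ P) (stack A *ᵥ x + stack B *ᵥ u)

/-- The stage cost plus the expected value of the successor state. -/
def qValue (x : Fin nx → ℝ) (u : Fin nu → ℝ) : ℝ :=
  qf Q x + qf R u + nextValue A B S P x u

/-- The right-hand side of the Riccati equation. -/
def bellman : Matrix (Fin nx) (Fin nx) ℝ :=
  Q + sandwich A A S P - (sandwich B A S P)ᵀ * (R + sandwich B B S P)⁻¹ * sandwich B A S P

/-- The minimizing gain for the value matrix `P`. -/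
def gain : Matrix (Fin nu) (Fin nx) ℝ :=
  -((R + sandwich B B S P)⁻¹ * sandwich B A S P)

lemma riccati_eq_zero_iff : riccati A B Q R P S = 0 ↔ bellman A B Q R S P = P := by
  unfold riccati bellman
  constructor <;> intro h
  · rw [← sub_eq_zero, ← neg_eq_zero, ← h]; abel
  · rw [← sub_eq_zero, ← neg_eq_zero] at h; rw [← h]; abel

variable {A B Q R S P}

lemma isLQRController_iff {K : Matrix (Fin nu) (Fin nx) ℝ} :
    IsLQRController A B Q R S K ↔
      ∃ P : Matrix (Fin nx) (Fin nx) ℝ, P.PosSemidef ∧ bellman A B Q R S P = P ∧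
        K = gain A B R S P := by
  simp only [IsLQRController, riccati_eq_zero_iff, gain]

lemma sandwich_self_posSemidef {m : ℕ} (M : Fin (nw + 1) → Matrix (Fin nx) (Fin m) ℝ)
    (hS : S.PosSemidef) (hP : P.PosSemidef) : (sandwich M M S P).PosSemidef := by
  simpa [sandwich, Matrix.conjTranspose_eq_transpose_of_trivial] using
    (hS.kronecker hP).conjTranspose_mul_mul_same (stack M)

lemma add_sandwich_posDef (hR : R.PosDef) (hS : S.PosSemidef) (hP : P.PosSemidef) :
    (R + sandwich B B S P).PosDef :=
  hR.add_posSemidef (sandwich_self_posSemidef B hS hP)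

lemma nextValue_eq (hS : S.PosSemidef) (hP : P.PosSemidef) (x : Fin nx → ℝ) (u : Fin nu → ℝ) :
    nextValue A B S P x u = qf (sandwich A A S P) x
      + 2 * (u ⬝ᵥ sandwich B A S P *ᵥ x) + qf (sandwich B B S P) u := by
  rw [nextValue, add_comm (stack A *ᵥ x), qf_vec_add (hS.kronecker hP).isHermitian, qf_mulVec, qf_mulVec]
  have : (stack B *ᵥ u) ⬝ᵥ (S ⊗ₖ P) *ᵥ (stack A *ᵥ x) = u ⬝ᵥ sandwich B A S P *ᵥ x := by
    simp only [sandwich, ← Matrix.mulVec_mulVec]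
    rw [Matrix.dotProduct_transpose_mulVec, dotProduct_comm]
  rw [this]; simp only [sandwich]; ring

lemma nextValue_nonneg (hS : S.PosSemidef) (hP : P.PosSemidef) (x : Fin nx → ℝ)
    (u : Fin nu → ℝ) : 0 ≤ nextValue A B S P x u :=
  qf_nonneg (hS.kronecker hP) _

/-- Completion of squares. -/
lemma qValue_eq (hR : R.PosDef) (hS : S.PosSemidef) (hP : P.PosSemidef)
    (x : Fin nx → ℝ) (u : Fin nu → ℝ) :
    qValue A B Q R S P x u = qf (bellman A B Q R S P) x
      + qf (R + sandwich B B S P) (u - gain A B R S P *ᵥ x) := by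
  have hM := add_sandwich_posDef (B := B) hR hS hP
  rw [qValue, nextValue_eq hS hP, bellman, gain]
  set M := R + sandwich B B S P with hMdef
  set H := sandwich B A S P
  have hMM : M * M⁻¹ = 1 := Matrix.mul_nonsing_inv _ ((Matrix.isUnit_iff_isUnit_det _).mp hM.isUnit)
  have h1 : qf M u = qf R u + qf (sandwich B B S P) u := qf_add _ _ _
  have hinv : (M⁻¹)ᵀ = M⁻¹ := by
    simpa [Matrix.conjTranspose_eq_transpose_of_trivial] using hM.inv.isHermitian.eq
  rw [Matrix.neg_mulVec, sub_neg_eq_add, qf_vec_add hM.isHermitian, h1, qf_mulVec, qf_sub, qf_add,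
    Matrix.mulVec_mulVec, ← Matrix.mul_assoc, hMM, Matrix.one_mul, Matrix.transpose_mul, hinv]
  have h2 : Hᵀ * M⁻¹ * M * (M⁻¹ * H) = Hᵀ * M⁻¹ * H := by
    rw [Matrix.mul_assoc _ M, ← Matrix.mul_assoc M, hMM, Matrix.one_mul]
  rw [h2]; ring

lemma qValue_gain (hR : R.PosDef) (hS : S.PosSemidef) (hP : P.PosSemidef) (x : Fin nx → ℝ) :
    qValue A B Q R S P x (gain A B R S P *ᵥ x) = qf (bellman A B Q R S P) x := by
  rw [qValue_eq hR hS hP, sub_self, qf_vec_zero, add_zero]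

lemma qf_bellman_le (hR : R.PosDef) (hS : S.PosSemidef) (hP : P.PosSemidef)
    (x : Fin nx → ℝ) (u : Fin nu → ℝ) :
    qf (bellman A B Q R S P) x ≤ qValue A B Q R S P x u := by
  rw [qValue_eq hR hS hP]
  linarith [qf_nonneg (add_sandwich_posDef (B := B) hR hS hP).posSemidef (u - gain A B R S P *ᵥ x)]

/-- At a fixed point this gives `Q ≼ P`, which starts the comparison argument. -/
lemma qf_le_qf_bellman (hR : R.PosDef) (hS : S.PosSemidef) (hP : P.PosSemidef)
    (x : Fin nx → ℝ) : qf Q x ≤ qf (bellman A B Q R S P) x := by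
  rw [← qValue_gain hR hS hP, qValue]
  linarith [qf_nonneg hR.posSemidef (gain A B R S P *ᵥ x),
    nextValue_nonneg (A := A) (B := B) hS hP x (gain A B R S P *ᵥ x)]

lemma bellman_isHermitian (hQ : Q.IsHermitian) (hR : R.PosDef) (hS : S.PosSemidef)
    (hP : P.PosSemidef) : (bellman A B Q R S P).IsHermitian := by
  refine (hQ.add (sandwich_self_posSemidef A hS hP).isHermitian).sub ?_
  have := Matrix.isHermitian_conjTranspose_mul_mul (sandwich B A S P)
    (add_sandwich_posDef (B := B) hR hS hP).inv.isHermitian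
  rwa [Matrix.conjTranspose_eq_transpose_of_trivial] at this

lemma bellman_posSemidef (hQ : Q.PosDef) (hR : R.PosDef) (hS : S.PosSemidef)
    (hP : P.PosSemidef) : (bellman A B Q R S P).PosSemidef :=
  posSemidef_of_qf_nonneg (bellman_isHermitian hQ.isHermitian hR hS hP) fun x =>
    (qf_nonneg hQ.posSemidef x).trans (qf_le_qf_bellman hR hS hP x)

lemma nextValue_mono {P' : Matrix (Fin nx) (Fin nx) ℝ} (hS : S.PosSemidef)
    (hP : P.IsHermitian) (hP' : P'.IsHermitian) (h : ∀ x, qf P x ≤ qf P' x)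
    (x : Fin nx → ℝ) (u : Fin nu → ℝ) : nextValue A B S P x u ≤ nextValue A B S P' x u :=
  qf_kronecker_mono_right hS hP hP' h _

lemma nextValue_smul (c : ℝ) (x : Fin nx → ℝ) (u : Fin nu → ℝ) :
    nextValue A B S (c • P) x u = c * nextValue A B S P x u :=
  qf_kronecker_smul_right _ _ _ _

lemma nextValue_le_smul {S' : Matrix (Fin (nw + 1)) (Fin (nw + 1)) ℝ} {c : ℝ}
    (h : (c • S' - S).PosSemidef) (hP : P.PosSemidef) (x : Fin nx → ℝ) (u : Fin nu → ℝ) :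
    nextValue A B S P x u ≤ c * nextValue A B S' P x u := by
  rw [nextValue, nextValue, ← qf_kronecker_smul_left]
  exact qf_kronecker_mono_left h hP _

/-- A minimum of functions increasing in `P` is increasing: the minimizer for `P'` serves as a trial
input for `P`. -/
lemma bellman_mono {P' : Matrix (Fin nx) (Fin nx) ℝ} (hR : R.PosDef) (hS : S.PosSemidef)
    (hP : P.PosSemidef) (hP' : P'.PosSemidef) (h : ∀ x, qf P x ≤ qf P' x) (x : Fin nx → ℝ) :
    qf (bellman A B Q R S P) x ≤ qf (bellman A B Q R S P') x := by
  rw [← qValue_gain hR hS hP']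
  refine (qf_bellman_le hR hS hP x (gain A B R S P' *ᵥ x)).trans ?_
  unfold qValue
  linarith [nextValue_mono (A := A) (B := B) hS hP.isHermitian hP'.isHermitian h x
    (gain A B R S P' *ᵥ x)]

end Bellman

/-! ### Existence, comparison and uniqueness for the Riccati equation -/

section Riccati

variable {nw nx nu : ℕ} {A : Fin (nw + 1) → Matrix (Fin nx) (Fin nx) ℝ}
  {B : Fin (nw + 1) → Matrix (Fin nx) (Fin nu) ℝ}
  {Q : Matrix (Fin nx) (Fin nx) ℝ} {R : Matrix (Fin nu) (Fin nu) ℝ}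
  {S S' : Matrix (Fin (nw + 1)) (Fin (nw + 1)) ℝ} {P P' : Matrix (Fin nx) (Fin nx) ℝ}

/-- A subsolution of the Bellman equation is dominated by every solution. -/
theorem qf_le_of_le_qValue (hQ : Q.PosDef) (hR : R.PosDef) (hS : S.PosSemidef)
    (hP : P.PosSemidef) (hfix : bellman A B Q R S P = P) (hP' : P'.PosSemidef)
    (h : ∀ x, qf P' x ≤ qValue A B Q R S P' x (gain A B R S P *ᵥ x)) (x : Fin nx → ℝ) :
    qf P' x ≤ qf P x := by
  obtain ⟨c, hc1, hc⟩ := exists_qf_le hQ P'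
  obtain ⟨b, hb1, hb⟩ := exists_qf_le hQ P
  have hQP : ∀ x, qf Q x ≤ qf P x := fun x => by
    simpa [hfix] using qf_le_qf_bellman (A := A) (B := B) (Q := Q) hR hS hP x
  have hb0 : 0 < b := by linarith
  have hbinv : 0 ≤ 1 - b⁻¹ := sub_nonneg.mpr (inv_le_one_of_one_le₀ hb1)
  -- If `P' ≼ t P`, one step along the gain of `P` gives `P' ≼ t P - (t - 1) (stage cost)`. The
  -- stage cost is at least `b⁻¹ P`, so the excess `t - 1` shrinks by the factor `1 - b⁻¹`.
  have key : ∀ k : ℕ, ∀ x, qf P' x ≤ (1 + (1 - b⁻¹) ^ k * c) * qf P x := by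
    intro k
    induction k with
    | zero =>
      intro x
      nlinarith [hc x, hQP x, qf_nonneg hP x]
    | succ k ih =>
      intro x
      set t := 1 + (1 - b⁻¹) ^ k * c with ht
      have ht1 : 0 ≤ t - 1 := by simp only [ht, add_sub_cancel_left]; positivity
      have h1 := qValue_gain (A := A) (B := B) (Q := Q) hR hS hP x
      rw [hfix, qValue] at h1
      have h2 := h x
      set u := gain A B R S P *ᵥ x
      have h3 : nextValue A B S P' x u ≤ t * nextValue A B S P x u := by
        rw [← nextValue_smul]
        refine nextValue_mono hS hP'.isHermitian (hP.smul (by linarith)).isHermitian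
          (fun x => ?_) x u
        rw [qf_smul]; exact ih x
      have h4 : b⁻¹ * qf P x ≤ qf Q x := by
        rw [inv_mul_le_iff₀ hb0]; exact hb x
      have h5 := qf_nonneg hR.posSemidef u
      rw [qValue] at h2
      have h6 : qf P' x ≤ t * qf P x - (t - 1) * (qf Q x + qf R u) := by
        rw [← h1]; linarith
      have h7 : (t - 1) * (b⁻¹ * qf P x) ≤ (t - 1) * (qf Q x + qf R u) :=
        mul_le_mul_of_nonneg_left (by linarith) ht1
      calc qf P' x ≤ t * qf P x - (t - 1) * (b⁻¹ * qf P x) := by linarith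
        _ = _ := by rw [ht]; ring
  have hlim : Tendsto (fun k : ℕ => (1 + (1 - b⁻¹) ^ k * c) * qf P x) atTop
      (𝓝 ((1 + 0 * c) * qf P x)) :=
    ((((tendsto_pow_atTop_nhds_zero_of_lt_one hbinv
      (by linarith [inv_pos.mpr hb0])).mul_const c).const_add 1).mul_const _)
  simpa using ge_of_tendsto' hlim fun k => key k x

/-- A solution is a subsolution along every gain, in particular along that of the other solution, so
each dominates the other. -/
theorem bellman_fixed_unique (hQ : Q.PosDef) (hR : R.PosDef) (hS : S.PosSemidef)
    (hP : P.PosSemidef) (hfix : bellman A B Q R S P = P) (hP' : P'.PosSemidef)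
    (hfix' : bellman A B Q R S P' = P') : P' = P := by
  refine eq_of_qf_eq hP'.isHermitian hP.isHermitian fun x => le_antisymm ?_ ?_
  · refine qf_le_of_le_qValue hQ hR hS hP hfix hP' (fun x => ?_) x
    simpa [hfix'] using qf_bellman_le (A := A) (B := B) (Q := Q) hR hS hP' x _
  · refine qf_le_of_le_qValue hQ hR hS hP' hfix' hP (fun x => ?_) x
    simpa [hfix] using qf_bellman_le (A := A) (B := B) (Q := Q) hR hS hP x _

theorem isLQRController_unique (hQ : Q.PosDef) (hR : R.PosDef) (hS : S.PosSemidef)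
    {K K' : Matrix (Fin nu) (Fin nx) ℝ} (hK : IsLQRController A B Q R S K)
    (hK' : IsLQRController A B Q R S K') : K' = K := by
  obtain ⟨P, hP, hfix, rfl⟩ := isLQRController_iff.mp hK
  obtain ⟨P', hP', hfix', rfl⟩ := isLQRController_iff.mp hK'
  rw [bellman_fixed_unique hQ hR hS hP hfix hP' hfix']

lemma continuous_sandwich {m n : ℕ} (M : Fin (nw + 1) → Matrix (Fin nx) (Fin m) ℝ)
    (N : Fin (nw + 1) → Matrix (Fin nx) (Fin n) ℝ)
    (S : Matrix (Fin (nw + 1)) (Fin (nw + 1)) ℝ) : Continuous (sandwich M N S) := by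
  have : Continuous fun P : Matrix (Fin nx) (Fin nx) ℝ => S ⊗ₖ P :=
    continuous_matrix fun i j => by
      simp only [Matrix.kroneckerMap_apply]
      exact continuous_const.mul (continuous_id.matrix_elem _ _)
  exact (continuous_const.matrix_mul this).matrix_mul continuous_const

/-- Positive semidefiniteness of `P` keeps `R + G(P)` positive definite, so its inverse is
continuous there. -/
lemma continuousAt_bellman (hR : R.PosDef) (hS : S.PosSemidef) (hP : P.PosSemidef) :
    ContinuousAt (bellman A B Q R S) P := by
  have hdet : (R + sandwich B B S P).det ≠ 0 :=
    ((Matrix.isUnit_iff_isUnit_det _).mp (add_sandwich_posDef hR hS hP).isUnit).ne_zero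
  have hG : Continuous fun P => R + sandwich B B S P :=
    continuous_const.add (continuous_sandwich B B S)
  have hinv : ContinuousAt (fun P => (R + sandwich B B S P)⁻¹) P := by
    simp only [Matrix.inv_def, Ring.inverse_eq_inv']
    exact (hG.matrix_det.continuousAt.inv₀ hdet).smul hG.matrix_adjugate.continuousAt
  have hH := continuous_sandwich B A S
  have hmul : ContinuousAt (fun P => (sandwich B A S P)ᵀ * (R + sandwich B B S P)⁻¹
      * sandwich B A S P) P := by
    have h1 : Continuous fun p : Matrix (Fin nx) (Fin nu) ℝ × Matrix (Fin nu) (Fin nu) ℝ ×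
        Matrix (Fin nu) (Fin nx) ℝ => p.1 * p.2.1 * p.2.2 :=
      (continuous_fst.matrix_mul continuous_snd.fst).matrix_mul continuous_snd.snd
    exact ContinuousAt.comp (f := fun P => ((sandwich B A S P)ᵀ, (R + sandwich B B S P)⁻¹,
      sandwich B A S P)) (g := fun p => p.1 * p.2.1 * p.2.2) h1.continuousAt
      (hH.matrix_transpose.continuousAt.prodMk (hinv.prodMk hH.continuousAt))
  exact (continuous_const.add (continuous_sandwich A A S)).continuousAt.sub hmul

/-- A monotone bounded sequence of positive semidefinite matrices converges. -/
lemma exists_tendsto_of_qf_monotone {n : ℕ} {p : ℕ → Matrix (Fin n) (Fin n) ℝ}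
    {V : Matrix (Fin n) (Fin n) ℝ} (hp : ∀ k, (p k).PosSemidef)
    (hmono : ∀ x, Monotone fun k => qf (p k) x) (hle : ∀ k x, qf (p k) x ≤ qf V x) :
    ∃ P : Matrix (Fin n) (Fin n) ℝ, P.PosSemidef ∧ Tendsto p atTop (𝓝 P) := by
  have hq : ∀ x, ∃ l, Tendsto (fun k => qf (p k) x) atTop (𝓝 l) := fun x =>
    ⟨_, tendsto_atTop_ciSup (hmono x) ⟨qf V x, by rintro _ ⟨k, rfl⟩; exact hle k x⟩⟩
  choose l hl using hq
  have hent : ∀ i j, ∃ a, Tendsto (fun k => p k i j) atTop (𝓝 a) := fun i j => by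
    simp only [fun k => apply_eq_qf (hp k).isHermitian i j]
    exact ⟨_, (((hl _).sub (hl _)).sub (hl _)).div_const 2⟩
  choose P hP using hent
  have hlim : Tendsto p atTop (𝓝 (Matrix.of P)) :=
    tendsto_pi_nhds.mpr fun i => tendsto_pi_nhds.mpr fun j => hP i j
  refine ⟨Matrix.of P, posSemidef_of_qf_nonneg ?_ fun x => ?_, hlim⟩
  · have hT := (continuous_id.matrix_conjTranspose.tendsto (Matrix.of P)).comp hlim
    exact tendsto_nhds_unique (hT.congr fun k => (hp k).isHermitian.eq) hlim
  · have hc : Continuous fun M : Matrix (Fin n) (Fin n) ℝ => qf M x :=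
      continuous_const.dotProduct (continuous_id.matrix_mulVec continuous_const)
    exact ge_of_tendsto' ((hc.tendsto _).comp hlim) fun k => qf_nonneg (hp k) x

/-- A positive semidefinite supersolution yields a solution of the Riccati equation below it. -/
theorem exists_bellman_fixed (hQ : Q.PosDef) (hR : R.PosDef) (hS : S.PosSemidef)
    {V : Matrix (Fin nx) (Fin nx) ℝ} (hV : V.PosSemidef)
    (h : ∀ x, ∃ u, qValue A B Q R S V x u ≤ qf V x) :
    ∃ P : Matrix (Fin nx) (Fin nx) ℝ, P.PosSemidef ∧ bellman A B Q R S P = P ∧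
      ∀ x, qf P x ≤ qf V x := by
  -- Value iteration from zero increases and stays below the supersolution; its limit is a fixed
  -- point by continuity.
  set p : ℕ → Matrix (Fin nx) (Fin nx) ℝ := fun k => (bellman A B Q R S)^[k] 0 with hpdef
  have hsucc : ∀ k, p (k + 1) = bellman A B Q R S (p k) := fun k =>
    Function.iterate_succ_apply' _ _ _
  have hp : ∀ k, (p k).PosSemidef := fun k => by
    induction k with
    | zero => exact Matrix.PosSemidef.zero
    | succ k ih => rw [hsucc]; exact bellman_posSemidef hQ hR hS ih
  have hmono : ∀ k x, qf (p k) x ≤ qf (p (k + 1)) x := fun k => by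
    induction k with
    | zero => intro x; exact (qf_zero x).trans_le (qf_nonneg (hp 1) x)
    | succ k ih =>
      intro x
      rw [hsucc, hsucc (k + 1)]
      exact bellman_mono hR hS (hp _) (hp _) ih x
  have hle : ∀ k x, qf (p k) x ≤ qf V x := fun k => by
    induction k with
    | zero => intro x; exact (qf_zero x).trans_le (qf_nonneg hV x)
    | succ k ih =>
      intro x
      obtain ⟨u, hu⟩ := h x
      rw [hsucc]
      exact (bellman_mono hR hS (hp _) hV ih x).trans ((qf_bellman_le hR hS hV x u).trans hu)
  obtain ⟨P, hP, hlim⟩ :=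
    exists_tendsto_of_qf_monotone hp (fun x => monotone_nat_of_le_succ fun k => hmono k x) hle
  refine ⟨P, hP, ?_, fun x => ?_⟩
  · refine tendsto_nhds_unique ((continuousAt_bellman hR hS hP).tendsto.comp hlim) ?_
    refine ((tendsto_add_atTop_iff_nat 1).mpr hlim).congr fun k => ?_
    rw [hsucc]; rfl
  · have hc : Continuous fun M : Matrix (Fin nx) (Fin nx) ℝ => qf M x :=
      continuous_const.dotProduct (continuous_id.matrix_mulVec continuous_const)
    exact le_of_tendsto' ((hc.tendsto _).comp hlim) fun k => hle k x

/-! ### Perturbation of the covariance -/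

/-- Inflating `P` by `1 + t` gains `t` times the stage cost, at least `t ε P`. Replacing `S` by `S'`
loses at most `δ (1 + t) P ≼ 2 δ P`. With `t = 2 δ / ε` these balance, so `(1 + t) P` is a
supersolution for `S'`; the bound `δ ≤ ε / 2` ensures `t ≤ 1`. -/
theorem exists_bellman_fixed_of_cov_le (hQ : Q.PosDef) (hR : R.PosDef) (hS : S.PosSemidef)
    (hS' : S'.PosSemidef) {δ ε : ℝ} (hδ : 0 ≤ δ) (hε : 0 < ε) (hδε : δ ≤ ε / 2)
    (hSS' : ((1 + δ) • S - S').PosSemidef)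
    (hP : P.PosSemidef) (hfix : bellman A B Q R S P = P) (hPQ : ∀ x, ε * qf P x ≤ qf Q x) :
    ∃ P' : Matrix (Fin nx) (Fin nx) ℝ, P'.PosSemidef ∧ bellman A B Q R S' P' = P' ∧
      ∀ x, qf P' x ≤ (1 + 2 * δ / ε) * qf P x := by
  set t := 2 * δ / ε with ht
  have ht0 : 0 ≤ t := by positivity
  have ht1 : t ≤ 1 := by rw [ht, div_le_one hε]; linarith
  have htε : t * ε = 2 * δ := by rw [ht]; field_simp
  obtain ⟨P', hP', hfix', hle⟩ := exists_bellman_fixed (A := A) (B := B) hQ hR hS'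
    (hP.smul (show (0 : ℝ) ≤ 1 + t by positivity)) fun x => by
      refine ⟨gain A B R S P *ᵥ x, ?_⟩
      have h1 := qValue_gain (A := A) (B := B) (Q := Q) hR hS hP x
      rw [hfix, qValue] at h1
      set u := gain A B R S P *ᵥ x
      have h2 := nextValue_le_smul (A := A) (B := B) hSS' hP x u
      have h3 := nextValue_nonneg (A := A) (B := B) hS hP x u
      have h4 := qf_nonneg hR.posSemidef u
      have h5 := hPQ x
      have h6 := qf_nonneg hP x
      rw [qValue, nextValue_smul, qf_smul]
      have h7 : (1 + t) * nextValue A B S' P x u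
          ≤ (1 + t) * ((1 + δ) * nextValue A B S P x u) :=
        mul_le_mul_of_nonneg_left h2 (by positivity)
      have h8 : t * (ε * qf P x) ≤ t * (qf Q x + qf R u) :=
        mul_le_mul_of_nonneg_left (by linarith) ht0
      have h9 : δ * (1 + t) * nextValue A B S P x u ≤ δ * 2 * qf P x := by
        apply mul_le_mul _ _ h3 (by positivity)
        · exact mul_le_mul_of_nonneg_left (by linarith) hδ
        · nlinarith
      have h10 : t * (ε * qf P x) = 2 * δ * qf P x := by rw [← mul_assoc, htε]
      rw [← h1] at h9 h10 ⊢
      nlinarith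
  exact ⟨P', hP', hfix', fun x => by simpa [qf_smul] using hle x⟩

/-- If two problems have comparable expected successor values, up to a factor `1 ± η`, then
their optimal gains differ by `O(η)`. -/
theorem qf_gain_sub_le (hQ : Q.PosDef) (hR : R.PosDef) (hS : S.PosSemidef) (hS' : S'.PosSemidef)
    (hP : P.PosSemidef) (hfix : bellman A B Q R S P = P)
    (hP' : P'.PosSemidef) (hfix' : bellman A B Q R S' P' = P') {η : ℝ} (hη : 0 < η)
    (hη2 : η ≤ 1 / 2)
    (hle : ∀ x u, nextValue A B S' P' x u ≤ (1 + η) * nextValue A B S P x u)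
    (hge : ∀ x u, (1 - η) * nextValue A B S P x u ≤ nextValue A B S' P' x u)
    (x : Fin nx → ℝ) :
    qf (R + sandwich B B S P) (gain A B R S' P' *ᵥ x - gain A B R S P *ᵥ x)
      ≤ 4 * η ^ 2 * qf P x := by
  set v := gain A B R S P *ᵥ x with hv
  set v' := gain A B R S' P' *ᵥ x with hv'
  set d := v' - v with hd
  set m := qf (R + sandwich B B S P) d with hm
  set m' := qf (R + sandwich B B S' P') d with hm'
  have hm0 : 0 ≤ m := qf_nonneg (add_sandwich_posDef hR hS hP).posSemidef d
  have hp0 : 0 ≤ qf P x := qf_nonneg hP x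
  -- At `x = 0` only the terms quadratic in the input remain, which compares the curvatures of the
  -- two problems.
  have hmm : (1 - η) * m ≤ m' := by
    have h1 := hge 0 d
    rw [nextValue_eq hS hP, nextValue_eq hS' hP'] at h1
    simp only [qf_vec_zero, Matrix.mulVec_zero, dotProduct_zero, mul_zero, zero_add] at h1
    rw [hm, hm', qf_add, qf_add]
    nlinarith [qf_nonneg hR.posSemidef d]
  have hF : ∀ s : ℝ, qValue A B Q R S P x (v + s • d) = qf P x + s ^ 2 * m := fun s => by
    rw [qValue_eq hR hS hP, hfix, ← hv, add_sub_cancel_left, qf_vec_smul]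
  have hF' : ∀ s : ℝ, qValue A B Q R S' P' x (v + s • d) = qf P' x + (s - 1) ^ 2 * m' :=
    fun s => by
      rw [qValue_eq hR hS' hP', hfix', ← hv',
        show v + s • d - v' = (s - 1) • d by rw [hd]; module, qf_vec_smul]
  have hcost : ∀ u, 0 ≤ qf Q x + qf R u := fun u =>
    add_nonneg (qf_nonneg hQ.posSemidef x) (qf_nonneg hR.posSemidef u)
  have hup : ∀ u, qValue A B Q R S' P' x u ≤ (1 + η) * qValue A B Q R S P x u := fun u => by
    have := hle x u
    have := mul_nonneg hη.le (hcost u)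
    simp only [qValue]; nlinarith
  have hlo : ∀ u, (1 - η) * qValue A B Q R S P x u ≤ qValue A B Q R S' P' x u := fun u => by
    have := hge x u
    have := mul_nonneg hη.le (hcost u)
    simp only [qValue]; nlinarith
  -- Along the line through the minimizers `v` and `v'`, the two objectives are `qf P x + s² m` and
  -- `qf P' x + (s - 1)² m'`. Comparing them at `s = τ` and `s = -τ` cancels `qf P' x` and leaves `4
  -- τ m' ≤ 2 η (qf P x + τ² m)`. With `m ≤ 2 m'`, the choice `τ η = 1/2` absorbs the `m` term and
  -- yields the order `η²`; a comparison at the minimizers alone would give only order `η`.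
  set τ := 1 / (2 * η) with hτ
  have hτη : τ * η = 1 / 2 := by rw [hτ]; field_simp
  have hτ0 : 0 < τ := by positivity
  have h1 := hlo (v + τ • d)
  have h2 := hup (v + (-τ) • d)
  rw [hF, hF'] at h1 h2
  have h3 : 4 * τ * m' ≤ 2 * η * (qf P x + τ ^ 2 * m) := by nlinarith
  have hmm' : m ≤ 2 * m' := by nlinarith
  have h4 : 2 * τ * m ≤ 4 * τ * m' := by nlinarith
  have h5 : 2 * η * (qf P x + τ ^ 2 * m) = 2 * η * qf P x + τ * m := by
    linear_combination 2 * τ * m * hτη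
  have h6 : τ * m ≤ 2 * η * qf P x := by linarith
  have h7 : η * (τ * m) ≤ η * (2 * η * qf P x) := mul_le_mul_of_nonneg_left h6 hη.le
  have h8 : η * (τ * m) = m / 2 := by linear_combination m * hτη
  linarith

/-- The gain that is optimal for a covariance within relative distance `δ` of the true one
is suboptimal by a relative amount `O(δ²)`: an explicit supersolution. -/
theorem exists_bellman_fixed_suboptimal (hQ : Q.PosDef) (hR : R.PosDef) (hS : S.PosSemidef)
    (hS' : S'.PosSemidef) {δ ε : ℝ} (hδ : 0 < δ) (hε : 0 < ε) (hε1 : ε ≤ 1)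
    (hδε : δ ≤ ε ^ 2 / 200) (hle : ((1 + δ) • S - S').PosSemidef)
    (hge : ((1 + 2 * δ) • S' - S).PosSemidef)
    (hP : P.PosSemidef) (hfix : bellman A B Q R S P = P) (hPQ : ∀ x, ε * qf P x ≤ qf Q x) :
    ∃ P' : Matrix (Fin nx) (Fin nx) ℝ, P'.PosSemidef ∧ bellman A B Q R S' P' = P' ∧
      ∀ x, qValue A B Q R S ((1 + 4608 / ε ^ 3 * δ ^ 2) • P) x (gain A B R S' P' *ᵥ x)
        ≤ (1 + 4608 / ε ^ 3 * δ ^ 2) * qf P x := by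
  have hδε' : δ ≤ ε / 200 := by nlinarith
  obtain ⟨P', hP', hfix', hP'P⟩ := exists_bellman_fixed_of_cov_le hQ hR hS hS' hδ.le hε
    (by linarith) hle hP hfix hPQ
  refine ⟨P', hP', hfix', ?_⟩
  -- The larger of the two relative errors: `P'` against `P` costs `2 δ / ε`, while the reverse
  -- comparison costs `2 (2 δ) / (ε / 2) = 8 δ / ε`.
  set a := 8 * δ / ε with ha
  have ha0 : 0 < a := by positivity
  have haε : a ≤ ε / 25 := by rw [ha, div_le_iff₀ hε]; nlinarith
  have hδa : 8 * δ ≤ a := by rw [ha, le_div_iff₀ hε]; nlinarith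
  have hup : ∀ x, qf P' x ≤ (1 + a) * qf P x := fun x => by
    refine (hP'P x).trans (mul_le_mul_of_nonneg_right ?_ (qf_nonneg hP x))
    rw [ha]; gcongr; norm_num
  have hlo : ∀ x, qf P x ≤ (1 + a) * qf P' x := by
    -- The roles of the two problems are exchanged. Since `P' ≼ 2 P`, the coercivity constant for
    -- `P'` is `ε / 2`; uniqueness identifies the resulting solution with `P`.
    obtain ⟨P'', hP'', hfix'', h⟩ := exists_bellman_fixed_of_cov_le (ε := ε / 2) hQ hR hS' hS
      (by positivity) (by positivity) (by linarith) hge hP' hfix' fun x => by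
        have h1 : qf P' x ≤ 2 * qf P x :=
          (hup x).trans (mul_le_mul_of_nonneg_right (by linarith) (qf_nonneg hP x))
        have h2 := mul_le_mul_of_nonneg_left h1 (show 0 ≤ ε / 2 by positivity)
        linarith [hPQ x]
    rw [bellman_fixed_unique hQ hR hS hP hfix hP'' hfix''] at h
    intro x
    convert h x using 2
    rw [ha]; field_simp; ring
  set η := 3 * a with hη
  have hnle : ∀ x u, nextValue A B S' P' x u ≤ (1 + η) * nextValue A B S P x u := fun x u => by
    have h1 := nextValue_le_smul (A := A) (B := B) hle hP' x u
    have h2 : nextValue A B S P' x u ≤ (1 + a) * nextValue A B S P x u := by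
      rw [← nextValue_smul]
      exact nextValue_mono hS hP'.isHermitian (hP.smul (by positivity)).isHermitian
        (fun x => by rw [qf_smul]; exact hup x) x u
    have h3 := nextValue_nonneg (A := A) (B := B) hS hP x u
    calc _ ≤ (1 + δ) * ((1 + a) * nextValue A B S P x u) :=
          h1.trans (mul_le_mul_of_nonneg_left h2 (by positivity))
      _ = ((1 + δ) * (1 + a)) * nextValue A B S P x u := by ring
      _ ≤ _ := mul_le_mul_of_nonneg_right (by nlinarith) h3
  have hnge : ∀ x u, (1 - η) * nextValue A B S P x u ≤ nextValue A B S' P' x u := fun x u => by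
    have h1 := nextValue_le_smul (A := A) (B := B) hge hP x u
    have h2 : nextValue A B S' P x u ≤ (1 + a) * nextValue A B S' P' x u := by
      rw [← nextValue_smul]
      exact nextValue_mono hS' hP.isHermitian (hP'.smul (by positivity)).isHermitian
        (fun x => by rw [qf_smul]; exact hlo x) x u
    have h3 := nextValue_nonneg (A := A) (B := B) hS' hP' x u
    have h4 : nextValue A B S P x u ≤ (1 + η) * nextValue A B S' P' x u :=
      calc _ ≤ (1 + 2 * δ) * ((1 + a) * nextValue A B S' P' x u) :=
            h1.trans (mul_le_mul_of_nonneg_left h2 (by positivity))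
        _ = ((1 + 2 * δ) * (1 + a)) * nextValue A B S' P' x u := by ring
        _ ≤ _ := mul_le_mul_of_nonneg_right (by nlinarith) h3
    calc _ ≤ (1 - η) * ((1 + η) * nextValue A B S' P' x u) :=
          mul_le_mul_of_nonneg_left h4 (by linarith)
      _ = (1 - η ^ 2) * nextValue A B S' P' x u := by ring
      _ ≤ 1 * nextValue A B S' P' x u :=
          mul_le_mul_of_nonneg_right (by nlinarith [sq_nonneg η]) h3
      _ = _ := one_mul _
  intro x
  have hgain := qf_gain_sub_le hQ hR hS hS' hP hfix hP' hfix' (by positivity) (by linarith)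
    hnle hnge x
  have hsq := qValue_eq (A := A) (B := B) (Q := Q) hR hS hP x (gain A B R S' P' *ᵥ x)
  rw [hfix, qValue] at hsq
  have hκ : 4608 / ε ^ 3 * δ ^ 2 = 8 / ε * η ^ 2 := by rw [hη, ha]; field_simp; norm_num
  rw [hκ, qValue, nextValue_smul]
  set u := gain A B R S' P' *ᵥ x
  set e := qf (R + sandwich B B S P) (u - gain A B R S P *ᵥ x)
  -- Inflating `P` by `1 + c` gains at least `c ε P = 8 η² P`, which covers the loss `(1 + c) e ≤ 2
  -- e ≤ 8 η² P` from using the wrong gain.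
  set c := 8 / ε * η ^ 2 with hc
  have hcε : c * ε = 8 * η ^ 2 := by rw [hc]; field_simp
  have hc0 : 0 ≤ c := by positivity
  have hc1 : c ≤ 1 := by
    have : η ≤ 3 * ε / 25 := by linarith
    have : η ^ 2 ≤ (3 * ε / 25) ^ 2 := by gcongr
    rw [hc, div_mul_eq_mul_div, div_le_one hε]
    nlinarith
  have hRu := qf_nonneg hR.posSemidef u
  have h1 : c * (ε * qf P x) ≤ c * (qf Q x + qf R u) :=
    mul_le_mul_of_nonneg_left (by linarith [hPQ x]) hc0
  rw [← mul_assoc, hcε] at h1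
  have he0 : 0 ≤ e := qf_nonneg (add_sandwich_posDef hR hS hP).posSemidef _
  have h2 : c * e ≤ e := mul_le_of_le_one_left he0 hc1
  have h3 : nextValue A B S P x u = qf P x + e - (qf Q x + qf R u) := by linarith
  rw [h3]
  nlinarith

end Riccati

/-! ### One step of the system -/

section OneStep

variable {nw nx nu : ℕ} {A : Fin (nw + 1) → Matrix (Fin nx) (Fin nx) ℝ}
  {B : Fin (nw + 1) → Matrix (Fin nx) (Fin nu) ℝ}
  {S : Matrix (Fin (nw + 1)) (Fin (nw + 1)) ℝ} {P : Matrix (Fin nx) (Fin nx) ℝ}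

/-- The noise vector augmented by the constant `1`. -/
def augNoise (w : Fin nw → ℝ) : Fin (nw + 1) → ℝ := Fin.cons 1 w

lemma noisyMatrix_mulVec {m n : ℕ} (M : Fin (nw + 1) → Matrix (Fin m) (Fin n) ℝ)
    (w : Fin nw → ℝ) (x : Fin n → ℝ) :
    noisyMatrix M w *ᵥ x = ∑ i, augNoise w i • (M i *ᵥ x) := by
  simp [noisyMatrix, augNoise, Fin.sum_univ_succ, Matrix.add_mulVec, Matrix.sum_mulVec,
    Matrix.smul_mulVec]

/-- The augmented noise has finite second moments, given by the matrix `S`. -/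
def HasSecondMoment (ν : Measure (Fin nw → ℝ)) (S : Matrix (Fin (nw + 1)) (Fin (nw + 1)) ℝ) :
    Prop :=
  ∀ i j, Integrable (fun v => augNoise v i * augNoise v j) ν ∧
    ∫ v, augNoise v i * augNoise v j ∂ν = S i j

lemma measurable_augNoise_apply (i : Fin (nw + 1)) :
    Measurable fun v : Fin nw → ℝ => augNoise v i := by
  refine Fin.cases ?_ (fun i => ?_) i
  · simp [augNoise]
  · simpa [augNoise] using measurable_pi_apply i

lemma hasSecondMoment_augCov {Ω : Type*} [MeasurableSpace Ω] {μ : Measure Ω}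
    [IsProbabilityMeasure μ] {w : Ω → Fin nw → ℝ} (hw : Measurable w)
    (hsq : ∀ i, MemLp (fun ω => w ω i) 2 μ) (hmean : ∀ i, ∫ ω, w ω i ∂μ = 0)
    {C : Matrix (Fin nw) (Fin nw) ℝ} (hcov : ∀ i j, ∫ ω, w ω i * w ω j ∂μ = C i j) :
    HasSecondMoment (μ.map w) (augCov C) := by
  intro i j
  have hm : Measurable fun v : Fin nw → ℝ => augNoise v i * augNoise v j :=
    (measurable_augNoise_apply i).mul (measurable_augNoise_apply j)
  rw [integrable_map_measure hm.aestronglyMeasurable hw.aemeasurable,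
    integral_map hw.aemeasurable hm.aestronglyMeasurable]
  refine Fin.cases ?_ (fun i => ?_) i <;> refine Fin.cases ?_ (fun j => ?_) j
  · simp [augNoise, augCov, Function.comp_def]
  · simpa [augNoise, augCov, Function.comp_def, hmean] using
      (hsq j).integrable one_le_two
  · simpa [augNoise, augCov, Function.comp_def, hmean] using
      (hsq i).integrable one_le_two
  · simpa [augNoise, augCov, Function.comp_def, Pi.mul_def, hcov] using
      (hsq i).integrable_mul (hsq j)

/-- The quadratic form of `S` at `y` is the expectation of the square of `y` paired with the
augmented noise. -/
lemma HasSecondMoment.posSemidef {ν : Measure (Fin nw → ℝ)} (h : HasSecondMoment ν S) :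
    S.PosSemidef := by
  refine posSemidef_of_qf_nonneg ?_ fun y => ?_
  · ext i j
    rw [Matrix.conjTranspose_apply, star_trivial, ← (h i j).2, ← (h j i).2]
    simp only [mul_comm]
  · have : qf S y = ∫ v, (∑ i, y i * augNoise v i) ^ 2 ∂ν := by
      have h1 : ∀ v : Fin nw → ℝ, (∑ i, y i * augNoise v i) ^ 2
          = ∑ i, ∑ j, y i * y j * (augNoise v i * augNoise v j) := fun v => by
        rw [sq, Finset.sum_mul_sum]
        exact Finset.sum_congr rfl fun i _ => Finset.sum_congr rfl fun j _ => by ring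
      simp only [h1]
      rw [integral_finsetSum _ fun i _ => integrable_finsetSum _ fun j _ =>
        (h i j).1.const_mul _]
      simp only [qf, dotProduct, Matrix.mulVec, Finset.mul_sum]
      refine Finset.sum_congr rfl fun i _ => ?_
      rw [integral_finsetSum _ fun j _ => (h i j).1.const_mul _]
      refine Finset.sum_congr rfl fun j _ => ?_
      rw [integral_const_mul, (h i j).2]; ring
    rw [this]
    exact integral_nonneg fun v => sq_nonneg _

lemma lintegral_qf_noisyMatrix {ν : Measure (Fin nw → ℝ)} (h : HasSecondMoment ν S)
    (hP : P.PosSemidef) (x : Fin nx → ℝ) (u : Fin nu → ℝ) :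
    ∫⁻ v, ENNReal.ofReal (qf P (noisyMatrix A v *ᵥ x + noisyMatrix B v *ᵥ u)) ∂ν
      = ENNReal.ofReal (nextValue A B S P x u) := by
  set z : Fin (nw + 1) → Fin nx → ℝ := fun i => A i *ᵥ x + B i *ᵥ u with hz
  have h1 : ∀ v, qf P (noisyMatrix A v *ᵥ x + noisyMatrix B v *ᵥ u)
      = ∑ i, ∑ j, (augNoise v i * augNoise v j) * (z i ⬝ᵥ P *ᵥ z j) := fun v => by
    rw [noisyMatrix_mulVec, noisyMatrix_mulVec, ← Finset.sum_add_distrib]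
    simp only [← smul_add, qf, Matrix.mulVec_sum, sum_dotProduct, dotProduct_sum,
      Matrix.mulVec_smul, smul_dotProduct, dotProduct_smul, smul_eq_mul, Finset.mul_sum, hz]
    rw [Finset.sum_comm]
    exact Finset.sum_congr rfl fun i _ => Finset.sum_congr rfl fun j _ => by ring
  have h2 : nextValue A B S P x u = ∑ i, ∑ j, S i j * (z i ⬝ᵥ P *ᵥ z j) := by
    rw [nextValue, qf_kronecker]
    rfl
  have hint : ∀ i, Integrable
      (fun v => ∑ j, (augNoise v i * augNoise v j) * (z i ⬝ᵥ P *ᵥ z j)) ν := fun i =>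
    integrable_finsetSum _ fun j _ => (h i j).1.mul_const _
  have h3 : ∫ v, qf P (noisyMatrix A v *ᵥ x + noisyMatrix B v *ᵥ u) ∂ν
      = nextValue A B S P x u := by
    simp only [h1, h2]
    rw [integral_finsetSum _ fun i _ => hint i]
    refine Finset.sum_congr rfl fun i _ => ?_
    rw [integral_finsetSum _ fun j _ => (h i j).1.mul_const _]
    refine Finset.sum_congr rfl fun j _ => ?_
    rw [integral_mul_const, (h i j).2]
  rw [← h3, ofReal_integral_eq_lintegral_ofReal]
  · simp only [h1]
    exact integrable_finsetSum _ fun i _ => hint i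
  · exact ae_of_all _ fun v => qf_nonneg hP _

lemma continuous_noisyMatrix {m n : ℕ} (M : Fin (nw + 1) → Matrix (Fin m) (Fin n) ℝ) :
    Continuous (noisyMatrix M) := by
  unfold noisyMatrix
  exact continuous_const.add
    (continuous_finsetSum _ fun i _ => (continuous_apply i).smul continuous_const)

lemma continuous_step (A : Fin (nw + 1) → Matrix (Fin nx) (Fin nx) ℝ)
    (B : Fin (nw + 1) → Matrix (Fin nx) (Fin nu) ℝ) :
    Continuous fun p : ((Fin nx → ℝ) × (Fin nu → ℝ)) × (Fin nw → ℝ) =>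
      noisyMatrix A p.2 *ᵥ p.1.1 + noisyMatrix B p.2 *ᵥ p.1.2 :=
  (((continuous_noisyMatrix A).comp continuous_snd).matrix_mulVec continuous_fst.fst).add
    (((continuous_noisyMatrix B).comp continuous_snd).matrix_mulVec continuous_fst.snd)

lemma measurable_step {Ω : Type*} {mΩ : MeasurableSpace Ω} {X : Ω → Fin nx → ℝ}
    {U : Ω → Fin nu → ℝ} {W : Ω → Fin nw → ℝ} (hX : Measurable X) (hU : Measurable U)
    (hW : Measurable W) :
    Measurable fun ω => noisyMatrix A (W ω) *ᵥ X ω + noisyMatrix B (W ω) *ᵥ U ω :=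
  Measurable.comp (g := fun p : ((Fin nx → ℝ) × (Fin nu → ℝ)) × (Fin nw → ℝ) =>
      noisyMatrix A p.2 *ᵥ p.1.1 + noisyMatrix B p.2 *ᵥ p.1.2)
    (f := fun ω => ((X ω, U ω), W ω)) (continuous_step A B).measurable
    ((hX.prodMk hU).prodMk hW)

lemma continuous_nextValue : Continuous fun p : (Fin nx → ℝ) × (Fin nu → ℝ) =>
    nextValue A B S P p.1 p.2 :=
  (continuous_qf _).comp ((continuous_const.matrix_mulVec continuous_fst).add
    (continuous_const.matrix_mulVec continuous_snd))

/-- Independence makes the joint law a product, so Tonelli averages over the noise with state and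
input frozen. Extended nonnegative integrals avoid any moment assumption on `X` and `U`. -/
lemma lintegral_qf_step {Ω : Type*} [MeasurableSpace Ω] {μ : Measure Ω}
    [IsProbabilityMeasure μ] {ν : Measure (Fin nw → ℝ)} (h : HasSecondMoment ν S)
    (hP : P.PosSemidef) {X : Ω → Fin nx → ℝ} {U : Ω → Fin nu → ℝ} {W : Ω → Fin nw → ℝ}
    (hX : Measurable X) (hU : Measurable U) (hW : Measurable W) (hν : μ.map W = ν)
    (hind : IndepFun (fun ω => (X ω, U ω)) W μ) :
    ∫⁻ ω, ENNReal.ofReal (qf P (noisyMatrix A (W ω) *ᵥ X ω + noisyMatrix B (W ω) *ᵥ U ω)) ∂μ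
      = ∫⁻ ω, ENNReal.ofReal (nextValue A B S P (X ω) (U ω)) ∂μ := by
  have hXU : Measurable fun ω => (X ω, U ω) := hX.prodMk hU
  have hmap := (indepFun_iff_map_prod_eq_prod_map_map hXU.aemeasurable hW.aemeasurable).mp hind
  have hf : Measurable fun p : ((Fin nx → ℝ) × (Fin nu → ℝ)) × (Fin nw → ℝ) =>
      ENNReal.ofReal (qf P (noisyMatrix A p.2 *ᵥ p.1.1 + noisyMatrix B p.2 *ᵥ p.1.2)) :=
    ((continuous_qf P).comp (continuous_step A B)).measurable.ennreal_ofReal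
  have hg : Measurable fun p : (Fin nx → ℝ) × (Fin nu → ℝ) =>
      ENNReal.ofReal (nextValue A B S P p.1 p.2) :=
    continuous_nextValue.measurable.ennreal_ofReal
  have : IsProbabilityMeasure (μ.map W) := Measure.isProbabilityMeasure_map hW.aemeasurable
  rw [← lintegral_map (f := fun p : ((Fin nx → ℝ) × (Fin nu → ℝ)) × (Fin nw → ℝ) =>
      ENNReal.ofReal (qf P (noisyMatrix A p.2 *ᵥ p.1.1 + noisyMatrix B p.2 *ᵥ p.1.2)))
      (g := fun ω => ((X ω, U ω), W ω)) hf (hXU.prodMk hW), hmap,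
    lintegral_prod _ hf.aemeasurable]
  subst hν
  simp only [lintegral_qf_noisyMatrix h hP]
  rw [lintegral_map (f := fun p : (Fin nx → ℝ) × (Fin nu → ℝ) =>
      ENNReal.ofReal (nextValue A B S P p.1 p.2)) hg hXU]

/-- The operator `M ↦ E [(A(w) + B(w) K)ᵀ M (A(w) + B(w) K)]`. -/
def lyapunov (A : Fin (nw + 1) → Matrix (Fin nx) (Fin nx) ℝ)
    (B : Fin (nw + 1) → Matrix (Fin nx) (Fin nu) ℝ)
    (S : Matrix (Fin (nw + 1)) (Fin (nw + 1)) ℝ) (K : Matrix (Fin nu) (Fin nx) ℝ)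
    (M : Matrix (Fin nx) (Fin nx) ℝ) : Matrix (Fin nx) (Fin nx) ℝ :=
  sandwich (fun i => A i + B i * K) (fun i => A i + B i * K) S M

lemma qf_lyapunov {K : Matrix (Fin nu) (Fin nx) ℝ} (M : Matrix (Fin nx) (Fin nx) ℝ) (x : Fin nx → ℝ) :
    qf (lyapunov A B S K M) x = nextValue A B S M x (K *ᵥ x) := by
  have : stack (fun i => A i + B i * K) *ᵥ x = stack A *ᵥ x + stack B *ᵥ (K *ᵥ x) := by
    have h : stack (fun i => A i + B i * K) = stack A + stack B * K := by
      ext p j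
      simp [stack, Matrix.mul_apply]
    rw [h, Matrix.add_mulVec, Matrix.mulVec_mulVec]
  rw [lyapunov, sandwich, ← qf_mulVec, this, nextValue]

end OneStep

/-! ### Trajectories and their cost -/

section Trajectories

variable {Ω : Type*} {nw nx nu : ℕ}
  {A : Fin (nw + 1) → Matrix (Fin nx) (Fin nx) ℝ}
  {B : Fin (nw + 1) → Matrix (Fin nx) (Fin nu) ℝ}
  {Q : Matrix (Fin nx) (Fin nx) ℝ} {R : Matrix (Fin nu) (Fin nu) ℝ}
  {S : Matrix (Fin (nw + 1)) (Fin (nw + 1)) ℝ} {P V : Matrix (Fin nx) (Fin nx) ℝ}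
  {w : ℕ → Ω → Fin nw → ℝ} {u : ℕ → Ω → Fin nu → ℝ} {K : Matrix (Fin nu) (Fin nx) ℝ}

/-- The information available before the noise `w k` is drawn. -/
abbrev past (w : ℕ → Ω → Fin nw → ℝ) (k : ℕ) : MeasurableSpace Ω :=
  ⨆ j : Fin k, MeasurableSpace.comap (w j) inferInstance

lemma past_mono (w : ℕ → Ω → Fin nw → ℝ) (k : ℕ) : past w k ≤ past w (k + 1) :=
  iSup_le fun j => le_iSup (fun j : Fin (k + 1) => MeasurableSpace.comap (w j) inferInstance)
    j.castSucc

lemma measurable_past_succ (w : ℕ → Ω → Fin nw → ℝ) (k : ℕ) : Measurable[past w (k + 1)] (w k) :=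
  measurable_iff_comap_le.mpr <|
    le_iSup (fun j : Fin (k + 1) => MeasurableSpace.comap (w j) inferInstance) (Fin.last k)

lemma measurable_past_step {k : ℕ} {X : Ω → Fin nx → ℝ} {U : Ω → Fin nu → ℝ}
    (hX : Measurable[past w k] X) (hU : Measurable[past w k] U) :
    Measurable[past w (k + 1)]
      fun ω => noisyMatrix A (w k ω) *ᵥ X ω + noisyMatrix B (w k ω) *ᵥ U ω := by
  exact measurable_step (hX.mono (past_mono w k) le_rfl) (hU.mono (past_mono w k) le_rfl)
    (measurable_past_succ w k)

lemma measurable_state (hu : NonAnticipative w u) (x₀ : Fin nx → ℝ) (k : ℕ) :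
    Measurable[past w k] (state A B w u x₀ k) := by
  induction k with
  | zero => exact measurable_const
  | succ k ih => exact measurable_past_step ih (hu k)

lemma closedLoop_succ (x₀ : Fin nx → ℝ) (k : ℕ) (ω : Ω) :
    closedLoop A B w K x₀ (k + 1) ω = noisyMatrix A (w k ω) *ᵥ closedLoop A B w K x₀ k ω
      + noisyMatrix B (w k ω) *ᵥ (K *ᵥ closedLoop A B w K x₀ k ω) := by
  rw [closedLoop, Matrix.add_mulVec, Matrix.mulVec_mulVec]

lemma measurable_closedLoop (x₀ : Fin nx → ℝ) (k : ℕ) :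
    Measurable[past w k] (closedLoop A B w K x₀ k) := by
  induction k with
  | zero => exact measurable_const
  | succ k ih =>
    have h : closedLoop A B w K x₀ (k + 1) = fun ω => _ := funext (closedLoop_succ x₀ k)
    rw [h]
    exact measurable_past_step ih
      ((continuous_const.matrix_mulVec continuous_id).measurable.comp ih)

lemma nonAnticipative_closedLoop (x₀ : Fin nx → ℝ) :
    NonAnticipative w fun k ω => K *ᵥ closedLoop A B w K x₀ k ω := fun k =>
  (continuous_const.matrix_mulVec continuous_id).measurable.comp (measurable_closedLoop x₀ k)

lemma state_closedLoop (x₀ : Fin nx → ℝ) :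
    state A B w (fun k ω => K *ᵥ closedLoop A B w K x₀ k ω) x₀ = closedLoop A B w K x₀ := by
  funext k
  induction k with
  | zero => rfl
  | succ k ih =>
    funext ω
    rw [closedLoop_succ, state, ih]

variable [MeasurableSpace Ω] {μ : Measure Ω}

lemma past_le (hw : ∀ k, Measurable (w k)) (k : ℕ) : past w k ≤ ‹MeasurableSpace Ω› :=
  iSup_le fun j => (hw j).comap_le

lemma indep_past (hw : ∀ k, Measurable (w k)) (hind : iIndepFun w μ) (k : ℕ) :
    Indep (past w k) (MeasurableSpace.comap (w k) inferInstance) μ := by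
  have h := indep_iSup_of_disjoint (fun i => (hw i).comap_le) hind
    (S := Set.Iio k) (T := {k}) (by simp)
  refine indep_of_indep_of_le_left (indep_of_indep_of_le_right h ?_) ?_
  · simp
  · exact iSup_le fun j => le_iSup₂_of_le (f := fun i _ => MeasurableSpace.comap (w i) _)
      (j : ℕ) j.2 le_rfl

/-- The standing assumptions on the noise: independent, with common second moment `S`. -/
structure IsNoise (μ : Measure Ω) (w : ℕ → Ω → Fin nw → ℝ)
    (S : Matrix (Fin (nw + 1)) (Fin (nw + 1)) ℝ) : Prop where
  measurable : ∀ k, Measurable (w k)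
  indep : iIndepFun w μ
  secondMoment : ∀ k, HasSecondMoment (μ.map (w k)) S

lemma IsNoise.posSemidef (hw : IsNoise μ w S) : S.PosSemidef := (hw.secondMoment 0).posSemidef

/-- The expected stage cost at time `k`. -/
def stageCost (μ : Measure Ω) (Q : Matrix (Fin nx) (Fin nx) ℝ) (R : Matrix (Fin nu) (Fin nu) ℝ)
    (x : ℕ → Ω → Fin nx → ℝ) (u : ℕ → Ω → Fin nu → ℝ) (k : ℕ) : ℝ≥0∞ :=
  ∫⁻ ω, ENNReal.ofReal (qf Q (x k ω) + qf R (u k ω)) ∂μ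

lemma measurable_stageCost {x : Ω → Fin nx → ℝ} {u : Ω → Fin nu → ℝ} (hx : Measurable x)
    (hu : Measurable u) : Measurable fun ω => ENNReal.ofReal (qf Q (x ω) + qf R (u ω)) :=
  (((continuous_qf Q).measurable.comp hx).add
    ((continuous_qf R).measurable.comp hu)).ennreal_ofReal

lemma quadCost_eq_tsum (hw : IsNoise μ w S) (hu : NonAnticipative w u) (x₀ : Fin nx → ℝ) :
    quadCost μ Q R (state A B w u x₀) u = ∑' k, stageCost μ Q R (state A B w u x₀) u k := by
  refine lintegral_tsum fun k => (measurable_stageCost ?_ ?_).aemeasurable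
  · exact (measurable_state hu x₀ k).mono (past_le hw.measurable k) le_rfl
  · exact Measurable.mono (hu k) (past_le hw.measurable k) le_rfl

variable [IsProbabilityMeasure μ]

lemma lintegral_qf_state_succ (hw : IsNoise μ w S) (hP : P.PosSemidef)
    (hu : NonAnticipative w u) (x₀ : Fin nx → ℝ) (k : ℕ) :
    ∫⁻ ω, ENNReal.ofReal (qf P (state A B w u x₀ (k + 1) ω)) ∂μ
      = ∫⁻ ω, ENNReal.ofReal (nextValue A B S P (state A B w u x₀ k ω) (u k ω)) ∂μ := by
  have hX := measurable_state (A := A) (B := B) hu x₀ k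
  have hU : Measurable[past w k] (u k) := hu k
  have hle := past_le hw.measurable k
  refine lintegral_qf_step (hw.secondMoment k) hP (hX.mono hle le_rfl) (hU.mono hle le_rfl)
    (hw.measurable k) rfl ?_
  exact indep_of_indep_of_le_left (indep_past hw.measurable hw.indep k)
    (measurable_iff_comap_le.mp (Measurable.prodMk hX hU))

lemma stageCost_add (hw : IsNoise μ w S) (hQ : Q.PosDef) (hR : R.PosDef) (hP : P.PosSemidef)
    (hu : NonAnticipative w u) (x₀ : Fin nx → ℝ) (k : ℕ) :
    stageCost μ Q R (state A B w u x₀) u k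
        + ∫⁻ ω, ENNReal.ofReal (qf P (state A B w u x₀ (k + 1) ω)) ∂μ
      = ∫⁻ ω, ENNReal.ofReal (qValue A B Q R S P (state A B w u x₀ k ω) (u k ω)) ∂μ := by
  have hle := past_le hw.measurable k
  rw [lintegral_qf_state_succ hw hP hu, stageCost, ← lintegral_add_left]
  · refine lintegral_congr fun ω => ?_
    rw [← ENNReal.ofReal_add, qValue]
    · exact add_nonneg (qf_nonneg hQ.posSemidef _) (qf_nonneg hR.posSemidef _)
    · exact nextValue_nonneg hw.posSemidef hP _ _
  · exact measurable_stageCost ((measurable_state hu x₀ k).mono hle le_rfl)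
      (Measurable.mono (hu k) hle le_rfl)

/-- A supersolution for the gain `K` bounds the closed-loop cost. -/
theorem closedLoopCost_le (hw : IsNoise μ w S) (hQ : Q.PosDef) (hR : R.PosDef)
    (hV : V.PosSemidef) (h : ∀ x, qValue A B Q R S V x (K *ᵥ x) ≤ qf V x) (x₀ : Fin nx → ℝ) :
    closedLoopCost μ A B Q R w K x₀ ≤ ENNReal.ofReal (qf V x₀) := by
  have hu := nonAnticipative_closedLoop (A := A) (B := B) (K := K) (w := w) x₀
  rw [closedLoopCost, ← state_closedLoop]
  simp only [state_closedLoop]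
  -- The trajectory is put back in the form `state` of a non-anticipative input, to which the series
  -- formula for the cost applies.
  nth_rw 1 [← state_closedLoop]
  rw [quadCost_eq_tsum hw hu]
  refine ENNReal.tsum_le_of_sum_range_le fun n => ?_
  set e : ℕ → ℝ≥0∞ := fun k => ∫⁻ ω, ENNReal.ofReal (qf V (closedLoop A B w K x₀ k ω)) ∂μ
  have hstep : ∀ k, stageCost μ Q R (closedLoop A B w K x₀)
      (fun k ω => K *ᵥ closedLoop A B w K x₀ k ω) k + e (k + 1) ≤ e k := fun k => by
    have := stageCost_add (A := A) (B := B) hw hQ hR hV hu x₀ k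
    simp only [state_closedLoop] at this
    rw [this]
    exact lintegral_mono fun ω => ENNReal.ofReal_le_ofReal (h _)
  have hsum : ∀ n, ∑ k ∈ Finset.range n, stageCost μ Q R (closedLoop A B w K x₀)
      (fun k ω => K *ᵥ closedLoop A B w K x₀ k ω) k + e n ≤ e 0 := fun n => by
    induction n with
    | zero => simp
    | succ n ih =>
      rw [Finset.sum_range_succ, add_assoc]
      exact (add_le_add_right (hstep n) _).trans ih
  have h0 : e 0 = ENNReal.ofReal (qf V x₀) := by simp [e, closedLoop]
  rw [state_closedLoop, ← h0]
  exact le_self_add.trans (hsum n)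

/-- A solution of the Riccati equation bounds the cost of every input from below. -/
theorem le_quadCost (hw : IsNoise μ w S) (hQ : Q.PosDef) (hR : R.PosDef)
    (hP : P.PosSemidef) (hfix : bellman A B Q R S P = P) (hu : NonAnticipative w u)
    (x₀ : Fin nx → ℝ) :
    ENNReal.ofReal (qf P x₀) ≤ quadCost μ Q R (state A B w u x₀) u := by
  rw [quadCost_eq_tsum hw hu]
  set s := stageCost μ Q R (state A B w u x₀) u with hs
  set e : ℕ → ℝ≥0∞ := fun k => ∫⁻ ω, ENNReal.ofReal (qf P (state A B w u x₀ k ω)) ∂μ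
  by_cases htop : ∑' k, s k = ⊤
  · rw [htop]; exact le_top
  have hstep : ∀ k, e k ≤ s k + e (k + 1) := fun k => by
    rw [hs, stageCost_add hw hQ hR hP hu]
    refine lintegral_mono fun ω => ENNReal.ofReal_le_ofReal ?_
    simpa [hfix] using qf_bellman_le (A := A) (B := B) (Q := Q) hR hw.posSemidef hP _ (u k ω)
  have hsum : ∀ n, e 0 ≤ ∑ k ∈ Finset.range n, s k + e n := fun n => by
    induction n with
    | zero => simp
    | succ n ih =>
      rw [Finset.sum_range_succ, add_assoc]
      exact ih.trans (add_le_add_right (hstep n) _)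
  have h0 : e 0 = ENNReal.ofReal (qf P x₀) := by simp [e, state]
  obtain ⟨b, hb1, hb⟩ := exists_qf_le hQ P
  -- The remainder is controlled by the stage cost, which tends to zero when the total cost is
  -- finite. Hence no stability of the input has to be assumed.
  have hes : ∀ n, e n ≤ ENNReal.ofReal b * s n := fun n => by
    rw [hs, stageCost, ← lintegral_const_mul' _ _ ENNReal.ofReal_ne_top]
    refine lintegral_mono fun ω => ?_
    rw [← ENNReal.ofReal_mul (by linarith)]
    refine ENNReal.ofReal_le_ofReal ((hb _).trans ?_)
    exact mul_le_mul_of_nonneg_left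
      (le_add_of_nonneg_right (qf_nonneg hR.posSemidef _)) (by linarith)
  have hlim : Tendsto (fun n => ∑' k, s k + ENNReal.ofReal b * s n) atTop
      (𝓝 (∑' k, s k + ENNReal.ofReal b * 0)) :=
    (ENNReal.Tendsto.const_mul (ENNReal.tendsto_atTop_zero_of_tsum_ne_top htop)
      (Or.inr ENNReal.ofReal_ne_top)).const_add _
  rw [mul_zero, add_zero] at hlim
  rw [← h0]
  exact ge_of_tendsto' hlim fun n =>
    (hsum n).trans (add_le_add (ENNReal.sum_le_tsum _) (hes n))

lemma le_closedLoopCost (hw : IsNoise μ w S) (hQ : Q.PosDef) (hR : R.PosDef)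
    (hP : P.PosSemidef) (hfix : bellman A B Q R S P = P) (x₀ : Fin nx → ℝ) :
    ENNReal.ofReal (qf P x₀) ≤ closedLoopCost μ A B Q R w K x₀ := by
  have h := le_quadCost hw hQ hR hP hfix
    (nonAnticipative_closedLoop (A := A) (B := B) (K := K) (w := w) x₀) x₀
  rwa [state_closedLoop] at h

theorem closedLoopCost_gain (hw : IsNoise μ w S) (hQ : Q.PosDef) (hR : R.PosDef)
    (hP : P.PosSemidef) (hfix : bellman A B Q R S P = P) (x₀ : Fin nx → ℝ) :
    closedLoopCost μ A B Q R w (gain A B R S P) x₀ = ENNReal.ofReal (qf P x₀) :=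
  le_antisymm
    (closedLoopCost_le hw hQ hR hP (fun x => by rw [qValue_gain hR hw.posSemidef hP, hfix]) x₀)
    (le_closedLoopCost hw hQ hR hP hfix x₀)

theorem optimalCost_eq (hw : IsNoise μ w S) (hQ : Q.PosDef) (hR : R.PosDef)
    (hP : P.PosSemidef) (hfix : bellman A B Q R S P = P) (x₀ : Fin nx → ℝ) :
    optimalCost μ A B Q R w x₀ = ENNReal.ofReal (qf P x₀) := by
  refine le_antisymm ?_ (le_iInf₂ fun u hu => le_quadCost hw hQ hR hP hfix hu x₀)
  rw [← closedLoopCost_gain hw hQ hR hP hfix]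
  refine (iInf₂_le _ (nonAnticipative_closedLoop (A := A) (B := B) (K := gain A B R S P) x₀)).trans
    ?_
  rw [state_closedLoop, closedLoopCost]

/-! ### Mean square stability -/

/-- Each step moves the dynamics from the state to the matrix, so `M` must stay universally
quantified in the induction. -/
lemma lintegral_qf_closedLoop (hw : IsNoise μ w S) (x₀ : Fin nx → ℝ) (k : ℕ) :
    ∀ {M : Matrix (Fin nx) (Fin nx) ℝ}, M.PosSemidef →
      ∫⁻ ω, ENNReal.ofReal (qf M (closedLoop A B w K x₀ k ω)) ∂μ
        = ENNReal.ofReal (qf ((lyapunov A B S K)^[k] M) x₀) := by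
  induction k with
  | zero => intro M _; simp [closedLoop]
  | succ k ih =>
    intro M hM
    have h := lintegral_qf_state_succ (A := A) (B := B) hw hM
      (nonAnticipative_closedLoop (A := A) (B := B) (K := K) (w := w) x₀) x₀ k
    simp only [state_closedLoop, ← qf_lyapunov] at h
    rw [h, ih (M := lyapunov A B S K M) (sandwich_self_posSemidef _ hw.posSemidef hM), Function.iterate_succ_apply]

/-- Matrices whose quadratic forms tend to zero are eventually small. -/
lemma exists_qf_le_half {n : ℕ} {p : ℕ → Matrix (Fin n) (Fin n) ℝ}
    (hp : ∀ k, (p k).IsHermitian) (h : ∀ x, Tendsto (fun k => qf (p k) x) atTop (𝓝 0)) :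
    ∃ k, ∀ x, qf (p k) x ≤ (1 / 2) * qf 1 x := by
  have hent : ∀ i j, Tendsto (fun k => p k i j) atTop (𝓝 0) := fun i j => by
    simp only [fun k => apply_eq_qf (hp k) i j]
    simpa using (((h _).sub (h _)).sub (h _)).div_const 2
  have hsum : Tendsto (fun k => ∑ i, ∑ j, |p k i j|) atTop (𝓝 0) := by
    simpa using tendsto_finsetSum Finset.univ fun i _ =>
      tendsto_finsetSum Finset.univ fun j _ => (hent i j).abs
  obtain ⟨k, hk⟩ := (hsum.eventually (gt_mem_nhds (show (0 : ℝ) < 1 / 2 by norm_num))).exists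
  refine ⟨k, fun x => le_trans ?_ (mul_le_mul_of_nonneg_right hk.le
    (qf_nonneg Matrix.PosSemidef.one x))⟩
  rw [qf_one]
  have hx : ∀ i, x i ^ 2 ≤ x ⬝ᵥ x := fun i => by
    rw [sq]
    exact Finset.single_le_sum (f := fun i => x i * x i) (fun i _ => mul_self_nonneg _)
      (Finset.mem_univ i)
  generalize x ⬝ᵥ x = s at hx ⊢
  simp only [qf, dotProduct, Matrix.mulVec, Finset.mul_sum, Finset.sum_mul]
  refine Finset.sum_le_sum fun i _ => Finset.sum_le_sum fun j _ => ?_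
  have h1 : |x i * x j| ≤ s := by
    rw [abs_le]
    constructor <;> nlinarith [hx i, hx j, sq_nonneg (x i + x j), sq_nonneg (x i - x j)]
  calc x i * (p k i j * x j) ≤ |x i * (p k i j * x j)| := le_abs_self _
    _ = |p k i j| * |x i * x j| := by rw [← abs_mul]; ring_nf
    _ ≤ _ := mul_le_mul_of_nonneg_left h1 (abs_nonneg _)

/-- A mean square stabilizing gain admits a quadratic supersolution. -/
theorem exists_supersolution (hw : IsNoise μ w S) (Q : Matrix (Fin nx) (Fin nx) ℝ)
    (R : Matrix (Fin nu) (Fin nu) ℝ) (hK : MeanSquareStable μ A B w K) :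
    ∃ V : Matrix (Fin nx) (Fin nx) ℝ, V.PosSemidef ∧
      ∀ x, qValue A B Q R S V x (K *ᵥ x) ≤ qf V x := by
  set p : ℕ → Matrix (Fin nx) (Fin nx) ℝ := fun k => (lyapunov A B S K)^[k] 1 with hpdef
  have hsucc : ∀ k, p (k + 1) = lyapunov A B S K (p k) := fun k =>
    Function.iterate_succ_apply' _ _ _
  have hp : ∀ k, (p k).PosSemidef := fun k => by
    induction k with
    | zero => exact Matrix.PosSemidef.one
    | succ k ih => rw [hsucc]; exact sandwich_self_posSemidef _ hw.posSemidef ih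
  have hlim : ∀ x, Tendsto (fun k => qf (p k) x) atTop (𝓝 0) := fun x => by
    have h := hK x
    have h1 : ∀ k, ∫⁻ ω, ENNReal.ofReal
        (closedLoop A B w K x k ω ⬝ᵥ closedLoop A B w K x k ω) ∂μ
          = ENNReal.ofReal (qf (p k) x) := fun k => by
      simp only [← qf_one]
      exact lintegral_qf_closedLoop hw x k Matrix.PosSemidef.one
    simp only [h1] at h
    have h2 := (ENNReal.tendsto_toReal ENNReal.zero_ne_top).comp h
    simpa [Function.comp_def, ENNReal.toReal_ofReal (qf_nonneg (hp _) x)] using h2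
  obtain ⟨k, hk⟩ := exists_qf_le_half (fun k => (hp k).isHermitian) hlim
  -- The witness is the partial sum of `p j` over `j < k`, for which the Lyapunov operator
  -- telescopes. Stopping once `p k ≼ 1/2` avoids summing the series.
  have hV : ∀ k, ∃ V : Matrix (Fin nx) (Fin nx) ℝ, V.PosSemidef ∧
      ∀ x, nextValue A B S V x (K *ᵥ x) = qf V x - qf 1 x + qf (p k) x := fun k => by
    induction k with
    | zero =>
      refine ⟨0, Matrix.PosSemidef.zero, fun x => ?_⟩
      simp [nextValue, qf_zero, hpdef]
    | succ k ih =>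
      obtain ⟨V, hV, h⟩ := ih
      refine ⟨V + p k, hV.add (hp k), fun x => ?_⟩
      have h1 := h x
      have h2 := qf_lyapunov (A := A) (B := B) (S := S) (K := K) (p k) x
      rw [← hsucc] at h2
      simp only [nextValue] at h1 h2 ⊢
      rw [Matrix.kronecker_add, qf_add, qf_add, h1, ← h2]
      ring
  obtain ⟨V, hV, h⟩ := hV k
  obtain ⟨c, hc1, hc⟩ := exists_qf_le (Matrix.PosDef.one (n := Fin nx) (R := ℝ)) (Q + Kᵀ * R * K)
  -- Each step decreases `V` by at least half the squared norm, so the factor `2 c` pays for a stage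
  -- cost of at most `c` times the squared norm.
  refine ⟨(2 * c) • V, hV.smul (by linarith), fun x => ?_⟩
  have h1 := hc x
  rw [qf_add, ← qf_mulVec] at h1
  rw [qValue, nextValue_smul, h x, qf_smul]
  have h2 := mul_le_mul_of_nonneg_left (hk x) (show 0 ≤ 2 * c by linarith)
  nlinarith

end Trajectories

/-! ### Suboptimality of the empirical controller -/

section Suboptimality

variable {Ω : Type*} [MeasurableSpace Ω] {μ : Measure Ω} [IsProbabilityMeasure μ]
  {nw nx nu : ℕ} {A : Fin (nw + 1) → Matrix (Fin nx) (Fin nx) ℝ}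
  {B : Fin (nw + 1) → Matrix (Fin nx) (Fin nu) ℝ}
  {Q : Matrix (Fin nx) (Fin nx) ℝ} {R : Matrix (Fin nu) (Fin nu) ℝ}
  {S : Matrix (Fin (nw + 1)) (Fin (nw + 1)) ℝ} {P : Matrix (Fin nx) (Fin nx) ℝ}
  {w : ℕ → Ω → Fin nw → ℝ}

lemma CovBound.posSemidef {n : ℕ} {l r : ℝ} {S S' : Matrix (Fin n) (Fin n) ℝ}
    (h : CovBound l r S S') (hS : S.PosSemidef) (hl : -1 ≤ l) : S'.PosSemidef := by
  convert h.1.add (hS.smul (show 0 ≤ 1 + l by linarith)) using 1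
  module

lemma CovBound.smul_sub_posSemidef {n : ℕ} {l r δ : ℝ} {S S' : Matrix (Fin n) (Fin n) ℝ}
    (h : CovBound l r S S') (hS : S.PosSemidef) (hr : r ≤ δ) : ((1 + δ) • S - S').PosSemidef := by
  convert h.2.add (hS.smul (sub_nonneg.mpr hr)) using 1
  module

/-- Inverts the lower bound `S' ≽ (1 - δ) S`: for `δ ≤ 1/2`, `(1 + 2 δ) (1 - δ) ≥ 1`. -/
lemma CovBound.smul_sub_posSemidef' {n : ℕ} {l r δ : ℝ} {S S' : Matrix (Fin n) (Fin n) ℝ}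
    (h : CovBound l r S S') (hS : S.PosSemidef) (hδ : 0 ≤ δ) (hδ2 : δ ≤ 1 / 2) (hl : -δ ≤ l) :
    ((1 + 2 * δ) • S' - S).PosSemidef := by
  have h1 : 0 ≤ (1 + 2 * δ) * (1 + l) - 1 := by nlinarith
  convert (h.1.smul (show 0 ≤ 1 + 2 * δ by positivity)).add (hS.smul h1) using 1
  module

/-- A second-order bound on the suboptimality of the controller for an estimated covariance. -/
theorem exists_suboptimality_bound (hw : IsNoise μ w S) (hQ : Q.PosDef) (hR : R.PosDef)
    (hP : P.PosSemidef) (hfix : bellman A B Q R S P = P) {lb ub : ℕ → ℝ}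
    (hlb₁ : ∀ N, -1 ≤ lb N)
    (hlb : lb =O[atTop] fun N : ℕ => 1 / Real.sqrt (N : ℝ))
    (hub : ub =O[atTop] fun N : ℕ => 1 / Real.sqrt (N : ℝ)) :
    ∃ C : ℝ, ∀ᶠ N : ℕ in atTop, ∀ Shat : Matrix (Fin (nw + 1)) (Fin (nw + 1)) ℝ,
      CovBound (lb N) (ub N) S Shat →
      ∃ Khat : Matrix (Fin nu) (Fin nx) ℝ, IsLQRController A B Q R Shat Khat ∧
        (∀ K, IsLQRController A B Q R Shat K → K = Khat) ∧
        ∀ x₀ : Fin nx → ℝ, closedLoopCost μ A B Q R w Khat x₀ < ⊤ ∧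
          |(closedLoopCost μ A B Q R w Khat x₀).toReal
              - (closedLoopCost μ A B Q R w (gain A B R S P) x₀).toReal|
            ≤ C * (x₀ ⬝ᵥ x₀) / (N : ℝ) := by
  have hS := hw.posSemidef
  obtain ⟨b, hb1, hb⟩ := exists_qf_le hQ P
  obtain ⟨d, hd1, hd⟩ := exists_qf_le (Matrix.PosDef.one (n := Fin nx) (R := ℝ)) P
  have hb0 : 0 < b := by linarith
  set ε := b⁻¹ with hε
  have hε0 : 0 < ε := inv_pos.mpr hb0
  have hε1 : ε ≤ 1 := inv_le_one_of_one_le₀ hb1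
  have hPQ : ∀ x, ε * qf P x ≤ qf Q x := fun x => by
    rw [hε, inv_mul_le_iff₀ hb0]; exact hb x
  obtain ⟨c₁, hc₁, h₁⟩ := hlb.exists_pos
  obtain ⟨c₂, hc₂, h₂⟩ := hub.exists_pos
  set c := c₁ + c₂ with hc
  have hlim : Tendsto (fun N : ℕ => c * (1 / Real.sqrt (N : ℝ))) atTop (𝓝 0) := by
    simpa using ((tendsto_inv_atTop_zero.comp
      (Real.tendsto_sqrt_atTop.comp tendsto_natCast_atTop_atTop)).const_mul c)
  have hsmall : (0 : ℝ) < ε ^ 2 / 200 := by positivity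
  -- The relative suboptimality is `4608 / ε³ δ²` with `δ = c / √N`, and `d` bounds `qf P x₀` by the
  -- squared norm of `x₀`.
  refine ⟨4608 / ε ^ 3 * c ^ 2 * d, ?_⟩
  filter_upwards [h₁.bound, h₂.bound, hlim.eventually (gt_mem_nhds hsmall),
    eventually_gt_atTop 0] with N hl hr hδε hN Shat hcov
  have hN' : (0 : ℝ) < N := by exact_mod_cast hN
  have hsq : 0 < 1 / Real.sqrt (N : ℝ) := by positivity
  rw [Real.norm_of_nonneg hsq.le, Real.norm_eq_abs] at hl hr
  set δ := c * (1 / Real.sqrt (N : ℝ)) with hδ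
  have hδ0 : 0 < δ := by positivity
  have hlδ : -δ ≤ lb N := by
    have := (abs_le.mp hl).1
    have := mul_pos hc₂ hsq
    rw [hδ, hc]; linarith
  have hrδ : ub N ≤ δ := by
    have := (abs_le.mp hr).2
    have := mul_pos hc₁ hsq
    rw [hδ, hc]; linarith
  have hδ2 : δ ^ 2 = c ^ 2 / N := by
    rw [hδ, mul_pow, div_pow, Real.sq_sqrt hN'.le]; ring
  have hShat := hcov.posSemidef hS (hlb₁ N)
  obtain ⟨P', hP', hfix', hsup⟩ := exists_bellman_fixed_suboptimal (A := A) (B := B) hQ hR hS hShat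
    hδ0 hε0 hε1 hδε.le (hcov.smul_sub_posSemidef hS hrδ)
    (hcov.smul_sub_posSemidef' hS hδ0.le (by nlinarith) hlδ) hP hfix hPQ
  have hKhat := isLQRController_iff.mpr ⟨P', hP', hfix', rfl⟩
  refine ⟨_, hKhat, fun K hK => isLQRController_unique hQ hR hShat hKhat hK, fun x₀ => ?_⟩
  set κ := 4608 / ε ^ 3 * δ ^ 2 with hκ
  have hκ0 : 0 ≤ κ := by positivity
  have hle := closedLoopCost_le hw hQ hR (hP.smul (show 0 ≤ 1 + κ by positivity))
    (fun x => by rw [qf_smul]; exact hsup x) x₀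
  have hge := le_closedLoopCost (K := gain A B R Shat P') hw hQ hR hP hfix x₀
  have hlt := hle.trans_lt ENNReal.ofReal_lt_top
  refine ⟨hlt, ?_⟩
  have hp0 := qf_nonneg hP x₀
  rw [qf_smul] at hle
  have hle' := ENNReal.toReal_le_of_le_ofReal (by positivity) hle
  have hge' := (ENNReal.ofReal_le_iff_le_toReal hlt.ne).mp hge
  rw [closedLoopCost_gain hw hQ hR hP hfix, ENNReal.toReal_ofReal hp0,
    abs_of_nonneg (by linarith)]
  have hd' := hd x₀
  rw [qf_one] at hd'
  calc _ ≤ κ * qf P x₀ := by linarith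
    _ ≤ κ * (d * (x₀ ⬝ᵥ x₀)) := mul_le_mul_of_nonneg_left hd' hκ0
    _ = _ := by rw [hκ, hδ2]; ring

end Suboptimality

end MultNoiseLQR

end

theorem corollary1
    {Ω : Type*} [MeasurableSpace Ω] (μ : Measure Ω) [IsProbabilityMeasure μ]
    {nw nx nu : ℕ}
    (A : Fin (nw + 1) → Matrix (Fin nx) (Fin nx) ℝ)
    (B : Fin (nw + 1) → Matrix (Fin nx) (Fin nu) ℝ)
    (Q : Matrix (Fin nx) (Fin nx) ℝ) (hQ : Q.PosDef)
    (R : Matrix (Fin nu) (Fin nu) ℝ) (hR : R.PosDef)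
    -- the noise: i.i.d., square integrable, centred, with covariance `S`
    (w : ℕ → Ω → Fin nw → ℝ) (hw_meas : ∀ k, Measurable (w k))
    (hw_indep : iIndepFun w μ) (hw_ident : ∀ k, IdentDistrib (w k) (w 0) μ μ)
    (hw_sq : ∀ i, MemLp (fun ω => w 0 ω i) 2 μ)
    (hw_mean : ∀ i, ∫ ω, w 0 ω i ∂μ = 0)
    (S : Matrix (Fin nw) (Fin nw) ℝ)
    (hw_cov : ∀ i j, ∫ ω, w 0 ω i * w 0 ω j ∂μ = S i j)
    -- the system is mean square stabilizable
    (hstab : ∃ K : Matrix (Fin nu) (Fin nx) ℝ, MultNoiseLQR.MeanSquareStable μ A B w K)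
    -- the accuracy of the covariance estimate as a function of the sample size
    (lb ub : ℕ → ℝ) (hlb₁ : ∀ N, -1 ≤ lb N) (hlb₀ : ∀ N, lb N ≤ 0) (hub₀ : ∀ N, 0 ≤ ub N)
    (hlb : lb =O[atTop] fun N : ℕ => 1 / Real.sqrt (N : ℝ))
    (hub : ub =O[atTop] fun N : ℕ => 1 / Real.sqrt (N : ℝ)) :
    -- the nominal controller exists, is unique and optimal
    ∃ Kstar : Matrix (Fin nu) (Fin nx) ℝ,
      MultNoiseLQR.IsLQRController A B Q R (MultNoiseLQR.augCov S) Kstar ∧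
      (∀ K, MultNoiseLQR.IsLQRController A B Q R (MultNoiseLQR.augCov S) K → K = Kstar) ∧
      (∀ x₀, MultNoiseLQR.closedLoopCost μ A B Q R w Kstar x₀
          = MultNoiseLQR.optimalCost μ A B Q R w x₀ ∧
        MultNoiseLQR.closedLoopCost μ A B Q R w Kstar x₀ < ⊤) ∧
      -- for large `N`, the empirical controller exists, is unique and is `O(1/N)`-suboptimal,
      -- uniformly over the estimates that satisfy the bound
      ∃ C : ℝ, ∀ᶠ N : ℕ in atTop, ∀ Shat : Matrix (Fin (nw + 1)) (Fin (nw + 1)) ℝ,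
        MultNoiseLQR.CovBound (lb N) (ub N) (MultNoiseLQR.augCov S) Shat →
        ∃ Khat : Matrix (Fin nu) (Fin nx) ℝ,
          MultNoiseLQR.IsLQRController A B Q R Shat Khat ∧
          (∀ K, MultNoiseLQR.IsLQRController A B Q R Shat K → K = Khat) ∧
          ∀ x₀ : Fin nx → ℝ,
            MultNoiseLQR.closedLoopCost μ A B Q R w Khat x₀ < ⊤ ∧
            |(MultNoiseLQR.closedLoopCost μ A B Q R w Khat x₀).toReal
                - (MultNoiseLQR.closedLoopCost μ A B Q R w Kstar x₀).toReal|
              ≤ C * (x₀ ⬝ᵥ x₀) / (N : ℝ) := by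
  obtain ⟨K₀, hK₀⟩ := hstab
  have hw : MultNoiseLQR.IsNoise μ w (MultNoiseLQR.augCov S) :=
    ⟨hw_meas, hw_indep, fun k => by
      rw [(hw_ident k).map_eq]
      exact MultNoiseLQR.hasSecondMoment_augCov (hw_meas 0) hw_sq hw_mean hw_cov⟩
  -- Stabilizability enters only here, to give value iteration an upper bound.
  obtain ⟨V, hV, hVsup⟩ := MultNoiseLQR.exists_supersolution hw Q R hK₀
  obtain ⟨P, hP, hfix, -⟩ := MultNoiseLQR.exists_bellman_fixed hQ hR hw.posSemidef hV
    fun x => ⟨_, hVsup x⟩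
  have hKstar := MultNoiseLQR.isLQRController_iff.mpr ⟨P, hP, hfix, rfl⟩
  refine ⟨_, hKstar, fun K hK =>
    MultNoiseLQR.isLQRController_unique hQ hR hw.posSemidef hKstar hK, fun x₀ => ?_, ?_⟩
  · rw [MultNoiseLQR.closedLoopCost_gain hw hQ hR hP hfix,
      MultNoiseLQR.optimalCost_eq hw hQ hR hP hfix]
    exact ⟨rfl, ENNReal.ofReal_lt_top⟩
  exact MultNoiseLQR.exists_suboptimality_bound hw hQ hR hP hfix hlb₁ hlb hub
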